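/- For a function $f:[0,2]\to\mathbb{C}$ and an integer $L\ge 1$, let $Q_Lf$ be the polynomial of degree at most $L$ with $(Q_Lf)(1+\cos\frac{\ell\pi}{L})=f(1+\cos\frac{\ell\pi}{L})$ for $\ell=0,\dots,L$, and let $e_L:=f-Q_Lf$. For an integer $m\ge 0$ put $\varrho_m(s):=(s(2-s))^{m-1/2}$ and $\|g\|_{\varrho_m}:=\big(\int_0^2|g(s)|^2\varrho_m(s)\,\mathrm{d}s\big)^{1/2}\in[0,\infty]$. For $m\ge1$, let $W_m$ be the set of all continuous $f:[0,2]\to\mathbb{C}$ that are $m-1$ times continuously differentiable in $(0,2)$ with $f,\dots,f^{(m-1)}$ absolutely continuous on every compact subinterval of $(0,2)$, so that $f^{(m)}$ exists almost everywhere. (a) For every integer $m\ge 1$ there exists a constant $C_m>0$ such that, for all integers $L\ge 1$ with $L\ge m-1$ and all $f\in W_m$, $$\|e_L\|_{\varrho_0}+L^{-1}\|e_L'\|_{\varrho_1}\le C_m L^{-m}\|f^{(m)}\|_{\varrho_m}.$$ (b) For every integer $m$ and real $m_0$ with $m\ge m_0>5/2$ there exists a constant $C_{m_0,m}>0$ such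 that, for all integers $L\ge m-1$ and all $f\in W_m$, $$\|e_L'\|_{L^\infty(0,2)}\le C_{m_0,m}L^{m_0-m}\|f^{(m)}\|_{\varrho_m},$$ and, for all integers $L\ge m$ and all $f\in W_{m+1}$, $$\|\varrho_1 e_L''\|_{L^\infty(0,2)}\le C_{m_0,m}L^{m_0-m}\|f^{(m+1)}\|_{\varrho_{m+1}}.$$ (The right-hand sides may be infinite, in which case the estimates are void.) -/

import Mathlib

open MeasureTheory Set
open scoped ENNReal NNReal

noncomputable section

namespace ClenshawCurtis

/-- The weight `ϱ_m(s) = (s (2 - s))^(m - 1/2)` on `(0, 2)`. -/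
def rho (m : ℕ) (s : ℝ) : ℝ := (s * (2 - s)) ^ ((m : ℝ) - 1 / 2)

/-- The weighted norm `‖g‖_{ϱ_m} = (∫_0^2 |g(s)|² ϱ_m(s) ds)^(1/2)`, with values in `[0, ∞]`. -/
def rhoNorm (m : ℕ) (g : ℝ → ℂ) : ℝ≥0∞ :=
  (∫⁻ s in Ioo (0 : ℝ) 2, ‖g s‖ₑ ^ 2 * ENNReal.ofReal (rho m s)) ^ (1 / 2 : ℝ)

/-- The norm of `L^∞(0, 2)`, with values in `[0, ∞]`. -/
def supNorm (g : ℝ → ℂ) : ℝ≥0∞ := eLpNorm g ∞ (volume.restrict (Ioo (0 : ℝ) 2))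

/-- The shifted Chebyshev nodes `1 + cos (ℓ π / L)`. -/
def node (L l : ℕ) : ℝ := 1 + Real.cos (l * Real.pi / L)

/-- The polynomial `Q_L f` of degree at most `L` interpolating `f` at `node L l`, `l = 0, …, L`. -/
def interpolant (L : ℕ) (f : ℝ → ℂ) : Polynomial ℂ :=
  Lagrange.interpolate (Finset.range (L + 1)) (fun l => (node L l : ℂ)) (fun l => f (node L l))

/-- The interpolation error `e_L = f - Q_L f`. -/
def interpError (L : ℕ) (f : ℝ → ℂ) (s : ℝ) : ℂ := f s - (interpolant L f).eval (s : ℂ)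

/-- `f` is continuous on `[0, 2]` and belongs to `W^{m,1}_loc(0, 2)`: it is `m - 1` times
continuously differentiable in `(0, 2)`, and its derivatives of order `< m` are absolutely
continuous on every compact subinterval of `(0, 2)`. Then the derivative of order `m` exists
almost everywhere and is the weak one. No integrability at the endpoints is imposed. -/
structure LocSobolev (m : ℕ) (f : ℝ → ℂ) : Prop where
  continuousOn : ContinuousOn f (Icc 0 2)
  contDiffOn : ∀ k < m, ContDiffOn ℝ k f (Ioo 0 2)
  absCont : ∀ k < m, ∀ a b : ℝ, 0 < a → a ≤ b → b < 2 →
    AbsolutelyContinuousOnInterval (iteratedDeriv k f) a b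

end ClenshawCurtis

end

/-!
Under `s = 1 + cos θ` the Chebyshev series of `f` becomes a cosine series. The functions
`sin^m θ T_n^{(m)}(cos θ)`, `n ≥ m`, are orthogonal on `(0, π)`, so integrating the coefficients of
`f` by parts `m` times and using Bessel's inequality bounds `∑_{n ≥ m} n^{2m} |a_n|²` by
`‖f^{(m)}‖²_{ϱ_m}`; as `f` is regular only inside `(0, 2)`, this is done on `[1 - r, 1 + r]`, and
then `r → 1`.

At the nodes `T_n` agrees with some `T_{n'}`, `n' ≤ L`, so `e_L = ∑_{n > L} a_n (T_n - T_{n'})`.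
For the mean square, the frequencies `n'` are distinct as `n` ranges over a block of `L` consecutive
integers, so cosines (for `e_L`) and sines (for `e_L'`) are orthogonal on each block, and the blocks
are summed with Cauchy–Schwarz. Symmetric difference quotients and Fatou's lemma reach `e_L'`
without differentiating the series term by term. The uniform bounds use `|T_n'| ≤ n²` and
`ϱ_1 |T_n''| ≤ n³`. When the relevant sum of coefficients is infinite the estimate is void, and
otherwise the series converges absolutely.
-/

noncomputable section

open Filter Topology Real

namespace ClenshawCurtis

/-! ### Mean squares of trigonometric series -/

theorem lintegral_mul_sq_le {α : Type*} [MeasurableSpace α] {μ : Measure α} {f g : α → ℝ≥0∞}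
    (hf : AEMeasurable f μ) (hg : AEMeasurable g μ) :
    (∫⁻ x, f x * g x ∂μ) ^ 2 ≤ (∫⁻ x, f x ^ 2 ∂μ) * ∫⁻ x, g x ^ 2 ∂μ := by
  have h := ENNReal.lintegral_mul_le_Lp_mul_Lq μ (Real.HolderConjugate.two_two) hf hg
  simp only [Pi.mul_apply, ENNReal.rpow_ofNat] at h
  refine (pow_le_pow_left' h 2).trans_eq ?_
  simp only [mul_pow, ← ENNReal.rpow_mul_natCast]
  norm_num

theorem tsum_mul_sq_le {ι : Type*} (f g : ι → ℝ≥0∞) :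
    (∑' i, f i * g i) ^ 2 ≤ (∑' i, f i ^ 2) * ∑' i, g i ^ 2 := by
  let _ : MeasurableSpace ι := ⊤
  simpa only [lintegral_count] using
    lintegral_mul_sq_le (μ := Measure.count) (measurable_from_top (f := f)).aemeasurable
      (measurable_from_top (f := g)).aemeasurable

theorem mul_tsum_inv_sq_le {L : ℕ} (hL : 1 ≤ L) :
    (L : ℝ≥0∞) * ∑' n : ℕ, (if L ≤ n then (n : ℝ≥0∞)⁻¹ else 0) ^ 2 ≤ 2 := by
  have hterm (n : ℕ) : (if L ≤ n then (n : ℝ≥0∞)⁻¹ else 0) ^ 2 =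
      ENNReal.ofReal (if L ≤ n then ((n : ℝ) ^ 2)⁻¹ else 0) := by
    split_ifs with hn
    · have hn0 : (0 : ℝ) < n := by exact_mod_cast hL.trans hn
      rw [ENNReal.ofReal_inv_of_pos (by positivity), ENNReal.ofReal_pow hn0.le,
        ENNReal.ofReal_natCast, ENNReal.inv_pow]
    · simp
  rw [ENNReal.tsum_eq_iSup_nat, ENNReal.mul_iSup]
  refine iSup_le fun N => ?_
  have hfilter : (Finset.range N).filter (L ≤ ·) = Finset.Ioo (L - 1) N := by ext; simp; lia
  have hreal : (L : ℝ) * ∑ n ∈ Finset.Ioo (L - 1) N, ((n : ℝ) ^ 2)⁻¹ ≤ 2 := by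
    have h := sum_Ioo_inv_sq_le (α := ℝ) (L - 1) N
    rwa [Nat.cast_pred hL, sub_add_cancel, le_div_iff₀' (by exact_mod_cast hL)] at h
  rw [Finset.sum_congr rfl fun n _ => hterm n,
    ← ENNReal.ofReal_sum_of_nonneg fun n _ => by split_ifs <;> positivity,
    ← Finset.sum_filter, hfilter, ← ENNReal.ofReal_natCast, ← ENNReal.ofReal_mul (by positivity)]
  simpa using ENNReal.ofReal_le_ofReal hreal

theorem mul_tsum_sq_le {L : ℕ} (hL : 1 ≤ L) {a : ℕ → ℝ≥0∞} (ha : ∀ n < L, a n = 0) :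
    (L : ℝ≥0∞) * (∑' n, a n) ^ 2 ≤ 2 * ∑' n : ℕ, (n : ℝ≥0∞) ^ 2 * a n ^ 2 := by
  have hsplit (n : ℕ) : a n = (if L ≤ n then (n : ℝ≥0∞)⁻¹ else 0) * (n * a n) := by
    split_ifs with hn
    · rw [← mul_assoc, ENNReal.inv_mul_cancel (by simp; lia) (by simp), one_mul]
    · rw [ha n (by lia), mul_zero, mul_zero]
  calc (L : ℝ≥0∞) * (∑' n, a n) ^ 2
      = L * (∑' n : ℕ, (if L ≤ n then (n : ℝ≥0∞)⁻¹ else 0) * (n * a n)) ^ 2 := by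
        rw [tsum_congr hsplit]
    _ ≤ L * ((∑' n : ℕ, (if L ≤ n then (n : ℝ≥0∞)⁻¹ else 0) ^ 2) * ∑' n : ℕ, (n * a n) ^ 2) := by
        gcongr
        exact tsum_mul_sq_le _ _
    _ ≤ 2 * ∑' n : ℕ, (n : ℝ≥0∞) ^ 2 * a n ^ 2 := by
        simp only [← mul_assoc, mul_pow]
        gcongr
        exact mul_tsum_inv_sq_le hL

theorem enorm_sq_le_of_hasSum {E : Type*} [NormedAddCommGroup E] {B : ℕ → E} {G : E}
    (hB : HasSum B G) (h0 : B 0 = 0) :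
    ‖G‖ₑ ^ 2 ≤ 2 * ∑' k : ℕ, (k : ℝ≥0∞) ^ 2 * ‖B k‖ₑ ^ 2 := by
  have hCS := mul_tsum_sq_le le_rfl (a := fun k => ‖B k‖ₑ) fun n hn => by
    rw [Nat.lt_one_iff.1 hn, h0, enorm_zero]
  rw [Nat.cast_one, one_mul] at hCS
  refine le_trans ?_ hCS
  gcongr
  rw [← hB.tsum_eq]
  exact enorm_tsum_le_tsum_enorm

/-- A family of continuous functions, pairwise orthogonal in `L²(0, π)`, with squared norms at
most `π`: the properties shared by the cosines and the sines of integer frequency. -/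
structure IsOrthoSystem {ι : Type*} (φ : ι → ℝ → ℝ) : Prop where
  continuous : ∀ i, Continuous (φ i)
  orthogonal : ∀ i j, i ≠ j → ∫ θ in (0 : ℝ)..π, φ i θ * φ j θ = 0
  norm_le : ∀ i, ∫ θ in (0 : ℝ)..π, φ i θ * φ i θ ≤ π

theorem integral_cos_int_mul (j : ℤ) :
    ∫ θ in (0 : ℝ)..π, cos (j * θ) = if j = 0 then π else 0 := by
  split_ifs with h
  · simp [h]
  · rw [intervalIntegral.integral_comp_mul_left cos (Int.cast_ne_zero.2 h)]
    simp [sin_int_mul_pi]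

theorem integral_cos_mul_cos (i j : ℕ) :
    ∫ θ in (0 : ℝ)..π, cos (i * θ) * cos (j * θ) =
      ((if (i : ℤ) - j = 0 then π else 0) + (if (i : ℤ) + j = 0 then π else 0)) / 2 := by
  rw [← integral_cos_int_mul, ← integral_cos_int_mul, ← intervalIntegral.integral_add,
    ← intervalIntegral.integral_div]
  · congr 1 with θ
    push_cast
    rw [sub_mul, add_mul, cos_sub, cos_add]
    ring
  all_goals exact Continuous.intervalIntegrable (by fun_prop) _ _

theorem integral_sin_mul_sin (i j : ℕ) :
    ∫ θ in (0 : ℝ)..π, sin (i * θ) * sin (j * θ) =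
      ((if (i : ℤ) - j = 0 then π else 0) - (if (i : ℤ) + j = 0 then π else 0)) / 2 := by
  rw [← integral_cos_int_mul, ← integral_cos_int_mul, ← intervalIntegral.integral_sub,
    ← intervalIntegral.integral_div]
  · congr 1 with θ
    push_cast
    rw [sub_mul, add_mul, cos_sub, cos_add]
    ring
  all_goals exact Continuous.intervalIntegrable (by fun_prop) _ _

theorem isOrthoSystem_cos : IsOrthoSystem fun (n : ℕ) θ => cos (n * θ) where
  continuous n := by fun_prop
  orthogonal i j h := by
    rw [integral_cos_mul_cos, if_neg (by lia), if_neg (by lia), add_zero, zero_div]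
  norm_le i := by
    rw [integral_cos_mul_cos]
    split_ifs <;> linarith [pi_pos]

theorem isOrthoSystem_sin : IsOrthoSystem fun (n : ℕ) θ => sin (n * θ) where
  continuous n := by fun_prop
  orthogonal i j h := by
    rw [integral_sin_mul_sin, if_neg (by lia), if_neg (by lia), sub_zero, zero_div]
  norm_le i := by
    rw [integral_sin_mul_sin]
    split_ifs <;> linarith [pi_pos]

namespace IsOrthoSystem

variable {ι κ : Type*} {φ : ι → ℝ → ℝ}

theorem comp_injective (hφ : IsOrthoSystem φ) {τ : κ → ι} (hτ : τ.Injective) :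
    IsOrthoSystem fun k => φ (τ k) where
  continuous k := hφ.continuous (τ k)
  orthogonal _ _ hkl := hφ.orthogonal _ _ (hτ.ne hkl)
  norm_le k := hφ.norm_le (τ k)

theorem integral_sum_sq_le (hφ : IsOrthoSystem φ) (S : Finset ι) (α : ι → ℝ) :
    ∫ θ in (0 : ℝ)..π, (∑ i ∈ S, α i * φ i θ) ^ 2 ≤ π * ∑ i ∈ S, α i ^ 2 := by
  have hc := hφ.continuous
  have hexpand (θ : ℝ) : (∑ i ∈ S, α i * φ i θ) ^ 2 =
      ∑ i ∈ S, ∑ j ∈ S, α i * α j * (φ i θ * φ j θ) := by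
    rw [sq, Finset.sum_mul_sum]
    exact Finset.sum_congr rfl fun i _ => Finset.sum_congr rfl fun j _ => by ring
  simp_rw [hexpand]
  rw [intervalIntegral.integral_finsetSum
    (fun i _ => Continuous.intervalIntegrable (by fun_prop) _ _), Finset.mul_sum]
  refine Finset.sum_le_sum fun i hi => ?_
  rw [intervalIntegral.integral_finsetSum
    (fun i _ => Continuous.intervalIntegrable (by fun_prop) _ _), Finset.sum_eq_single_of_mem i hi]
  · rw [intervalIntegral.integral_const_mul]
    nlinarith [hφ.norm_le i, sq_nonneg (α i)]
  · intro j _ hji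
    rw [intervalIntegral.integral_const_mul, hφ.orthogonal i j hji.symm, mul_zero]

theorem integral_norm_sum_sq_le (hφ : IsOrthoSystem φ) (S : Finset ι) (α : ι → ℂ) :
    ∫ θ in (0 : ℝ)..π, ‖∑ i ∈ S, α i * (φ i θ : ℂ)‖ ^ 2 ≤ π * ∑ i ∈ S, ‖α i‖ ^ 2 := by
  have hc := hφ.continuous
  have hsplit (θ : ℝ) : ‖∑ i ∈ S, α i * (φ i θ : ℂ)‖ ^ 2 =
      (∑ i ∈ S, (α i).re * φ i θ) ^ 2 + (∑ i ∈ S, (α i).im * φ i θ) ^ 2 := by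
    rw [Complex.sq_norm, Complex.normSq_apply, Complex.re_sum, Complex.im_sum]
    simp only [Complex.re_mul_ofReal, Complex.im_mul_ofReal, sq]
  simp_rw [hsplit, Complex.sq_norm, Complex.normSq_apply, ← sq, Finset.sum_add_distrib, mul_add]
  rw [intervalIntegral.integral_add (Continuous.intervalIntegrable (by fun_prop) _ _)
    (Continuous.intervalIntegrable (by fun_prop) _ _)]
  exact add_le_add (hφ.integral_sum_sq_le S _) (hφ.integral_sum_sq_le S _)

theorem lintegral_enorm_sum_sq_le (hφ : IsOrthoSystem φ) (S : Finset ι) (α : ι → ℂ) :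
    ∫⁻ θ in Ioo 0 π, ‖∑ i ∈ S, α i * (φ i θ : ℂ)‖ₑ ^ 2 ≤
      ENNReal.ofReal π * ∑ i ∈ S, ‖α i‖ₑ ^ 2 := by
  have hc := hφ.continuous
  have hsq (z : ℂ) : ‖z‖ₑ ^ 2 = ENNReal.ofReal (‖z‖ ^ 2) := by
    rw [ENNReal.ofReal_pow (norm_nonneg _), ofReal_norm]
  have hcont : Continuous fun θ => ‖∑ i ∈ S, α i * (φ i θ : ℂ)‖ ^ 2 := by fun_prop
  simp_rw [hsq]
  rw [← ENNReal.ofReal_sum_of_nonneg (fun _ _ => sq_nonneg _), ← ENNReal.ofReal_mul pi_pos.le,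
    ← ofReal_integral_eq_lintegral_ofReal
      ((hcont.integrableOn_Icc (a := 0) (b := π)).mono_set Ioo_subset_Icc_self)
      (ae_of_all _ fun _ => sq_nonneg _), ← integral_Ioc_eq_integral_Ioo,
    ← intervalIntegral.integral_of_le pi_pos.le]
  exact ENNReal.ofReal_le_ofReal (hφ.integral_norm_sum_sq_le S α)

end IsOrthoSystem

theorem lintegral_enorm_sq_le_of_tendsto {α E : Type*} [MeasurableSpace α] {μ : Measure α}
    [NormedAddCommGroup E] [MeasurableSpace E] [OpensMeasurableSpace E] {g : ℕ → α → E} {G : α → E}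
    {C : ℝ≥0∞} (hg : ∀ n, AEMeasurable (g n) μ)
    (hlim : ∀ᵐ x ∂μ, G x ≠ 0 → Tendsto (fun n => g n x) atTop (𝓝 (G x)))
    (hC : ∀ n, ∫⁻ x, ‖g n x‖ₑ ^ 2 ∂μ ≤ C) : ∫⁻ x, ‖G x‖ₑ ^ 2 ∂μ ≤ C := by
  calc ∫⁻ x, ‖G x‖ₑ ^ 2 ∂μ ≤ ∫⁻ x, liminf (fun n => ‖g n x‖ₑ ^ 2) atTop ∂μ := by
        refine lintegral_mono_ae ?_
        filter_upwards [hlim] with x hx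
        by_cases h0 : G x = 0
        · simp [h0]
        · exact (((ENNReal.continuous_pow 2).tendsto _).comp (hx h0).enorm).liminf_eq.ge
    _ ≤ liminf (fun n => ∫⁻ x, ‖g n x‖ₑ ^ 2 ∂μ) atTop :=
        lintegral_liminf_le' fun n => (hg n).enorm.pow_const 2
    _ ≤ C := (liminf_le_liminf (Eventually.of_forall hC)).trans (by simp)

theorem IsOrthoSystem.lintegral_hasSum_sq_le {φ : ℕ → ℝ → ℝ} (hφ : IsOrthoSystem φ) (α : ℕ → ℂ)
    {G : ℝ → ℂ} (hG : ∀ θ ∈ Ioo 0 π, HasSum (fun n => α n * (φ n θ : ℂ)) (G θ)) :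
    ∫⁻ θ in Ioo 0 π, ‖G θ‖ₑ ^ 2 ≤ ENNReal.ofReal π * ∑' n, ‖α n‖ₑ ^ 2 := by
  have hc := hφ.continuous
  refine lintegral_enorm_sq_le_of_tendsto
    (g := fun N θ => ∑ n ∈ Finset.range N, α n * (φ n θ : ℂ))
    (fun N => (Continuous.measurable (by fun_prop)).aemeasurable)
    (ae_restrict_of_forall_mem measurableSet_Ioo fun θ hθ _ => (hG θ hθ).tendsto_sum_nat)
    fun N => (hφ.lintegral_enorm_sum_sq_le _ α).trans ?_
  gcongr
  exact ENNReal.sum_le_tsum _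

theorem hasSum_sum_block {E : Type*} [NormedAddCommGroup E] {L : ℕ} [NeZero L] {u : ℕ → E} {G : E}
    (hu : HasSum u G) : HasSum (fun k => ∑ j : Fin L, u (k * L + j)) G :=
  ((Nat.divModEquiv L).symm.hasSum_iff.2 hu).prod_fiberwise fun _ => hasSum_fintype _

theorem tsum_block {L : ℕ} [NeZero L] (u : ℕ → ℝ≥0∞) :
    ∑' k, ∑ j : Fin L, u (k * L + j) = ∑' n, u n := by
  simp_rw [← tsum_fintype (L := .unconditional _)]
  rw [← (Nat.divModEquiv L).symm.tsum_eq u]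
  exact (ENNReal.tsum_prod (f := fun k j => u ((Nat.divModEquiv L).symm (k, j)))).symm

theorem IsOrthoSystem.lintegral_hasSum_blocks_sq_le {φ : ℕ → ℝ → ℝ} (hφ : IsOrthoSystem φ)
    {L : ℕ} [NeZero L] {τ : ℕ → ℕ}
    (hτ : ∀ k, Function.Injective fun j : Fin L => τ (k * L + j))
    {α : ℕ → ℂ} (hα : ∀ n < L, α n = 0) {G : ℝ → ℂ}
    (hG : ∀ θ ∈ Ioo 0 π, HasSum (fun n => α n * (φ (τ n) θ : ℂ)) (G θ)) :
    (L : ℝ≥0∞) ^ 2 * ∫⁻ θ in Ioo 0 π, ‖G θ‖ₑ ^ 2 ≤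
      ENNReal.ofReal (2 * π) * ∑' n : ℕ, (n : ℝ≥0∞) ^ 2 * ‖α n‖ₑ ^ 2 := by
  have hc := hφ.continuous
  set B : ℕ → ℝ → ℂ := fun k θ => ∑ j : Fin L, α (k * L + j) * (φ (τ (k * L + j)) θ : ℂ)
  have hmeas (k : ℕ) : Measurable fun θ => ‖B k θ‖ₑ ^ 2 :=
    (show Continuous (B k) by fun_prop).measurable.enorm.pow_const 2
  have hB0 (θ : ℝ) : B 0 θ = 0 :=
    Finset.sum_eq_zero fun j _ => by rw [hα _ (by lia), zero_mul]
  have hpoint : ∀ θ ∈ Ioo 0 π, ‖G θ‖ₑ ^ 2 ≤ 2 * ∑' k : ℕ, (k : ℝ≥0∞) ^ 2 * ‖B k θ‖ₑ ^ 2 :=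
    fun θ hθ => enorm_sq_le_of_hasSum
      (hasSum_sum_block (u := fun n => α n * (φ (τ n) θ : ℂ)) (hG θ hθ)) (hB0 θ)
  have hblock (k : ℕ) : ∫⁻ θ in Ioo 0 π, ‖B k θ‖ₑ ^ 2 ≤
      ENNReal.ofReal π * ∑ j : Fin L, ‖α (k * L + j)‖ₑ ^ 2 :=
    (hφ.comp_injective (hτ k)).lintegral_enorm_sum_sq_le Finset.univ fun j => α (k * L + j)
  calc (L : ℝ≥0∞) ^ 2 * ∫⁻ θ in Ioo 0 π, ‖G θ‖ₑ ^ 2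
      ≤ L ^ 2 * ∫⁻ θ in Ioo 0 π, 2 * ∑' k : ℕ, (k : ℝ≥0∞) ^ 2 * ‖B k θ‖ₑ ^ 2 := by
        gcongr _ * ?_
        exact setLIntegral_mono' measurableSet_Ioo hpoint
    _ = 2 * ∑' k : ℕ, ((k * L : ℕ) : ℝ≥0∞) ^ 2 * ∫⁻ θ in Ioo 0 π, ‖B k θ‖ₑ ^ 2 := by
        rw [lintegral_const_mul _ (Measurable.tsum fun k => (hmeas k).const_mul _),
          lintegral_tsum fun k => ((hmeas k).const_mul _).aemeasurable, mul_left_comm,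
          ← ENNReal.tsum_mul_left]
        congr 1
        refine tsum_congr fun k => ?_
        rw [lintegral_const_mul _ (hmeas k), Nat.cast_mul, mul_pow]
        ring
    _ ≤ 2 * ∑' k : ℕ, ((k * L : ℕ) : ℝ≥0∞) ^ 2 *
          (ENNReal.ofReal π * ∑ j : Fin L, ‖α (k * L + j)‖ₑ ^ 2) := by
        gcongr with k
        exact hblock k
    _ ≤ 2 * ∑' k : ℕ, ENNReal.ofReal π *
          ∑ j : Fin L, ((k * L + j : ℕ) : ℝ≥0∞) ^ 2 * ‖α (k * L + j)‖ₑ ^ 2 := by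
        simp_rw [mul_left_comm _ (ENNReal.ofReal π), Finset.mul_sum]
        gcongr
        lia
    _ = ENNReal.ofReal (2 * π) * ∑' n : ℕ, (n : ℝ≥0∞) ^ 2 * ‖α n‖ₑ ^ 2 := by
        rw [ENNReal.tsum_mul_left, tsum_block fun n => (n : ℝ≥0∞) ^ 2 * ‖α n‖ₑ ^ 2,
          ENNReal.ofReal_mul two_pos.le, ENNReal.ofReal_ofNat, mul_assoc]

/-! ### Absolutely continuous functions -/

theorem absolutelyContinuousOnInterval_comp_antitoneOn {X : Type*} [PseudoMetricSpace X]
    {f : ℝ → X} {g : ℝ → ℝ} {a b c d : ℝ} {K : ℝ≥0}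
    (hf : AbsolutelyContinuousOnInterval f c d) (hg : AntitoneOn g (uIcc a b))
    (hK : LipschitzOnWith K g (uIcc a b)) (hm : MapsTo g (uIcc a b) (uIcc c d)) :
    AbsolutelyContinuousOnInterval (fun x => f (g x)) a b := by
  rw [absolutelyContinuousOnInterval_iff] at hf ⊢
  intro ε hε
  obtain ⟨δ, hδ, hfδ⟩ := hf ε hε
  refine ⟨δ / (K + 1), by positivity, fun E ⟨hmem, hdisj⟩ hlen => ?_⟩
  refine hfδ (E.1, fun i => (g (E.2 i).1, g (E.2 i).2))
    ⟨fun i hi => ⟨hm (hmem i hi).1, hm (hmem i hi).2⟩, fun i hi j hj hij => ?_⟩ ?_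
  · have hmin {x y : ℝ} (hx : x ∈ uIcc a b) (hy : y ∈ uIcc a b) : min x y ∈ uIcc a b :=
      min_rec' _ hx hy
    have hmax {x y : ℝ} (hx : x ∈ uIcc a b) (hy : y ∈ uIcc a b) : max x y ∈ uIcc a b :=
      max_rec' _ hx hy
    obtain ⟨hi₁, hi₂⟩ := hmem i hi
    obtain ⟨hj₁, hj₂⟩ := hmem j hj
    have hle := hdisj hi hj hij
    simp only [Function.onFun, uIoc, Ioc_disjoint_Ioc] at hle ⊢
    rw [← hg.map_min hi₁ hi₂, ← hg.map_min hj₁ hj₂, ← hg.map_max hi₁ hi₂, ← hg.map_max hj₁ hj₂,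
      ← hg.map_max (hmin hi₁ hi₂) (hmin hj₁ hj₂), ← hg.map_min (hmax hi₁ hi₂) (hmax hj₁ hj₂)]
    exact hg (hmin (hmax hi₁ hi₂) (hmax hj₁ hj₂)) (hmax (hmin hi₁ hi₂) (hmin hj₁ hj₂)) hle
  · calc ∑ i ∈ Finset.range E.1, dist (g (E.2 i).1) (g (E.2 i).2)
        ≤ ∑ i ∈ Finset.range E.1, K * dist (E.2 i).1 (E.2 i).2 :=
          Finset.sum_le_sum fun i hi => hK.dist_le_mul _ (hmem i hi).1 _ (hmem i hi).2
      _ ≤ (K + 1) * ∑ i ∈ Finset.range E.1, dist (E.2 i).1 (E.2 i).2 := by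
          rw [← Finset.mul_sum]
          gcongr
          exact le_add_of_nonneg_right zero_le_one
      _ < δ := by rwa [lt_div_iff₀' (by positivity)] at hlen

theorem absolutelyContinuousOnInterval_lipschitzWith_comp {X Y : Type*}
    [PseudoMetricSpace X] [PseudoMetricSpace Y] {f : ℝ → X} {g : X → Y} {a b : ℝ} {K : ℝ≥0}
    (hg : LipschitzWith K g) (hf : AbsolutelyContinuousOnInterval f a b) :
    AbsolutelyContinuousOnInterval (fun x => g (f x)) a b := by
  unfold AbsolutelyContinuousOnInterval at hf ⊢
  refine squeeze_zero (fun E => Finset.sum_nonneg fun _ _ => dist_nonneg) (fun E => ?_)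
    (by simpa using hf.const_mul (K : ℝ))
  rw [Finset.mul_sum]
  exact Finset.sum_le_sum fun i _ => hg.dist_le_mul _ _

section IntegrationByParts

variable {u : ℝ → ℂ} {v : ℝ → ℝ} {a b : ℝ}

theorem ae_deriv_clm_comp (hu : AbsolutelyContinuousOnInterval u a b) (φ : ℂ →L[ℝ] ℝ) :
    ∀ᵐ x, x ∈ uIoc a b → deriv (fun y => φ (u y)) x = φ (deriv u x) := by
  filter_upwards [hu.boundedVariationOn.ae_differentiableAt_of_mem_uIcc] with x hx hmem
  exact (φ.hasFDerivAt.comp_hasDerivAt x (hx (uIoc_subset_uIcc hmem)).hasDerivAt).deriv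

theorem intervalIntegrable_deriv_complex (hu : AbsolutelyContinuousOnInterval u a b) :
    IntervalIntegrable (deriv u) volume a b := by
  have hpart (φ : ℂ →L[ℝ] ℝ) : IntervalIntegrable (fun x => φ (deriv u x)) volume a b :=
    (absolutelyContinuousOnInterval_lipschitzWith_comp φ.lipschitz
      hu).intervalIntegrable_deriv.congr_ae
        ((ae_restrict_iff' measurableSet_uIoc).2 (ae_deriv_clm_comp hu φ))
  rw [intervalIntegrable_iff]
  exact Integrable.re_im_iff.1
    ⟨(hpart Complex.reCLM).def', (hpart Complex.imCLM).def'⟩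

theorem integral_smul_deriv_eq_neg (hu : AbsolutelyContinuousOnInterval u a b)
    (hv : AbsolutelyContinuousOnInterval v a b) (hva : v a = 0) (hvb : v b = 0) :
    ∫ x in a..b, v x • deriv u x = -∫ x in a..b, deriv v x • u x := by
  refine (SeparatingDual.eq_iff_forall_dual_eq (R := ℝ)).2 fun φ => ?_
  have hibp := (absolutelyContinuousOnInterval_lipschitzWith_comp
    φ.lipschitz hu).integral_mul_deriv_eq_deriv_mul hv
  rw [map_neg, ← φ.intervalIntegral_comp_comm
      ((intervalIntegrable_deriv_complex hu).continuousOn_smul hv.continuousOn),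
    ← φ.intervalIntegral_comp_comm (hv.intervalIntegrable_deriv.smul_continuousOn hu.continuousOn)]
  simp only [hva, hvb, mul_zero, zero_sub, sub_zero] at hibp
  simp only [map_smul, smul_eq_mul, mul_comm (deriv v _), hibp, neg_neg]
  refine intervalIntegral.integral_congr_ae ?_
  filter_upwards [ae_deriv_clm_comp hu φ] with x hx hmem
  rw [hx hmem, mul_comm]

end IntegrationByParts

/-! ### Derivatives of Chebyshev polynomials -/

/-- The value `T_n^{(k)}(x)` of the `k`-th derivative of the `n`-th Chebyshev polynomial. -/
def chebT (n k : ℕ) (x : ℝ) : ℝ :=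
  (Polynomial.derivative^[k] (Polynomial.Chebyshev.T ℝ n)).eval x

theorem chebT_zero_cos (n : ℕ) (θ : ℝ) : chebT n 0 (cos θ) = cos (n * θ) := by
  simp [chebT]

theorem hasDerivAt_chebT (n k : ℕ) (x : ℝ) : HasDerivAt (chebT n k) (chebT n (k + 1) x) x := by
  have h := Polynomial.hasDerivAt (Polynomial.derivative^[k] (Polynomial.Chebyshev.T ℝ n)) x
  rwa [← Function.iterate_succ_apply' (f := Polynomial.derivative)] at h

theorem contDiff_chebT (n k : ℕ) : ContDiff ℝ 1 (chebT n k) :=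
  contDiff_one_iff_deriv.2 ⟨fun x => (hasDerivAt_chebT n k x).differentiableAt, by
    simp_rw [funext fun x => (hasDerivAt_chebT n k x).deriv]
    exact continuous_iff_continuousAt.2 fun x => (hasDerivAt_chebT n (k + 1) x).continuousAt⟩

theorem hasDerivAt_chebT_cos (n k : ℕ) (θ : ℝ) :
    HasDerivAt (fun θ => chebT n k (cos θ)) (chebT n (k + 1) (cos θ) * -sin θ) θ :=
  (hasDerivAt_chebT n k (cos θ)).comp θ (hasDerivAt_cos θ)

theorem sin_sq_mul_chebT (n k : ℕ) (θ : ℝ) :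
    sin θ ^ 2 * chebT n (k + 2) (cos θ) =
      (2 * k + 1) * cos θ * chebT n (k + 1) (cos θ) -
        ((n : ℝ) ^ 2 - k ^ 2) * chebT n k (cos θ) := by
  rw [sin_sq]
  simpa [chebT] using
    Polynomial.Chebyshev.one_sub_X_sq_mul_iterate_derivative_T_eval (R := ℝ) n k (cos θ)

theorem hasDerivAt_sin_pow_mul_chebT (n k : ℕ) (θ : ℝ) :
    HasDerivAt (fun θ => sin θ ^ (2 * k + 1) * chebT n (k + 1) (cos θ))
      (((n : ℝ) ^ 2 - k ^ 2) * (sin θ ^ (2 * k) * chebT n k (cos θ))) θ := by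
  refine (((hasDerivAt_sin θ).pow (2 * k + 1)).mul
    (hasDerivAt_chebT_cos n (k + 1) θ)).congr_deriv ?_
  simp only [Nat.add_sub_cancel, Pi.pow_apply]
  push_cast
  linear_combination (-sin θ ^ (2 * k)) * sin_sq_mul_chebT n k θ

/-- The factor `∏_{j < m} (n² - j²)` relating the mean square of `sin^m θ T_n^{(m)}(cos θ)` to that
of `cos (n θ)`. -/
def lam (m n : ℕ) : ℝ := ∏ j ∈ Finset.range m, ((n : ℝ) ^ 2 - (j : ℝ) ^ 2)

theorem lam_succ (m n : ℕ) : lam (m + 1) n = lam m n * ((n : ℝ) ^ 2 - (m : ℝ) ^ 2) :=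
  Finset.prod_range_succ _ _

theorem integral_mul_chebT_succ {U U₁ : ℝ → ℂ} {r : ℝ} (n k : ℕ)
    (hU : AbsolutelyContinuousOnInterval U 0 π)
    (hderiv : ∀ θ ∈ Ioo 0 π, deriv U θ = (r * -sin θ) • U₁ θ) :
    r • ∫ θ in (0 : ℝ)..π, (sin θ ^ (2 * (k + 1)) * chebT n (k + 1) (cos θ)) • U₁ θ =
      ((n : ℝ) ^ 2 - k ^ 2) • ∫ θ in (0 : ℝ)..π, (sin θ ^ (2 * k) * chebT n k (cos θ)) • U θ := by
  set V : ℝ → ℝ := fun θ => sin θ ^ (2 * k + 1) * chebT n (k + 1) (cos θ) with hV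
  have hV_ac : AbsolutelyContinuousOnInterval V 0 π :=
    ((contDiff_sin.pow _).mul
      ((contDiff_chebT _ _).comp contDiff_cos)).contDiffOn.absolutelyContinuousOnInterval
  have hibp := integral_smul_deriv_eq_neg hU hV_ac (by simp [hV]) (by simp [hV])
  have hleft : ∫ θ in (0 : ℝ)..π, V θ • deriv U θ =
      -(r • ∫ θ in (0 : ℝ)..π, (sin θ ^ (2 * (k + 1)) * chebT n (k + 1) (cos θ)) • U₁ θ) := by
    rw [← intervalIntegral.integral_smul, ← intervalIntegral.integral_neg]
    simp only [intervalIntegral.integral_of_le pi_pos.le, integral_Ioc_eq_integral_Ioo]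
    refine setIntegral_congr_fun measurableSet_Ioo fun θ hθ => ?_
    simp only [hderiv θ hθ, hV, smul_smul, ← neg_smul]
    ring_nf
  have hright : ∫ θ in (0 : ℝ)..π, deriv V θ • U θ =
      ((n : ℝ) ^ 2 - k ^ 2) • ∫ θ in (0 : ℝ)..π, (sin θ ^ (2 * k) * chebT n k (cos θ)) • U θ := by
    simp_rw [hV, (hasDerivAt_sin_pow_mul_chebT n k _).deriv, mul_smul]
    rw [intervalIntegral.integral_smul]
  rwa [hleft, hright, neg_inj] at hibp

theorem integral_chebT_mul_chebT (m n n' : ℕ) :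
    ∫ θ in (0 : ℝ)..π, sin θ ^ (2 * m) * chebT n m (cos θ) * chebT n' m (cos θ) =
      lam m n * ∫ θ in (0 : ℝ)..π, cos (n * θ) * cos (n' * θ) := by
  induction m with
  | zero => simp [lam, chebT_zero_cos]
  | succ m ih =>
    have hstep := integral_mul_chebT_succ (U := fun θ => (chebT n' m (cos θ) : ℂ))
      (U₁ := fun θ => (chebT n' (m + 1) (cos θ) : ℂ)) (r := 1) n m
      (Complex.ofRealCLM.contDiff.comp
        ((contDiff_chebT n' m).comp contDiff_cos)).contDiffOn.absolutelyContinuousOnInterval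
      fun θ _ => by
        rw [(hasDerivAt_chebT_cos n' m θ).ofReal_comp.deriv, Complex.real_smul]
        push_cast
        ring
    simp only [Complex.real_smul, ← Complex.ofReal_mul, intervalIntegral.integral_ofReal,
      Complex.ofReal_inj, one_mul, ih] at hstep
    rw [hstep, lam_succ]
    ring

theorem deriv_comp_of_hasStrictDerivAt {𝕜 E : Type*} [NontriviallyNormedField 𝕜] [CompleteSpace 𝕜]
    [NormedAddCommGroup E] [NormedSpace 𝕜 E] {g : 𝕜 → E} {φ : 𝕜 → 𝕜} {φ' x : 𝕜}
    (hφ : HasStrictDerivAt φ φ' x) (hφ' : φ' ≠ 0) :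
    deriv (fun t => g (φ t)) x = φ' • deriv g (φ x) := by
  by_cases hg : DifferentiableAt 𝕜 g (φ x)
  · exact (hg.hasDerivAt.scomp x hφ.hasDerivAt).deriv
  · rw [deriv_zero_of_not_differentiableAt hg, smul_zero]
    refine deriv_zero_of_not_differentiableAt fun hcomp => hg ?_
    set ψ := hφ.localInverse φ φ' x hφ'
    have hψ : DifferentiableAt 𝕜 ψ (φ x) := (hφ.to_localInverse hφ').hasDerivAt.differentiableAt
    have hright : ∀ᶠ y in 𝓝 (φ x), φ (ψ y) = y :=
      (hφ.hasStrictFDerivAt_equiv hφ').eventually_right_inverse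
    have hψx : ψ (φ x) = x := (hφ.hasStrictFDerivAt_equiv hφ').localInverse_apply_image
    rw [← hψx] at hcomp
    exact (hcomp.comp (φ x) hψ).congr_of_eventuallyEq (hright.mono fun y hy => by simp [hy])

theorem lipschitzWith_one_add_mul_cos (r : ℝ≥0) :
    LipschitzWith r fun θ => 1 + r * cos θ := by
  refine LipschitzWith.of_dist_le_mul fun x y => ?_
  rw [dist_add_left, Real.dist_eq, ← mul_sub, abs_mul, NNReal.abs_eq]
  gcongr
  exact abs_cos_sub_cos_le x y

theorem LocSobolev.absolutelyContinuous_comp_cos {f : ℝ → ℂ} {m k : ℕ} (hf : LocSobolev m f)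
    (hk : k < m) {r : ℝ} (hr0 : 0 < r) (hr1 : r < 1) :
    AbsolutelyContinuousOnInterval (fun θ => iteratedDeriv k f (1 + r * cos θ)) 0 π := by
  lift r to ℝ≥0 using hr0.le
  refine absolutelyContinuousOnInterval_comp_antitoneOn
    (hf.absCont k hk (1 - r) (1 + r) (by linarith) (by linarith) (by linarith)) ?_
    (lipschitzWith_one_add_mul_cos r).lipschitzOnWith ?_
  · rw [uIcc_of_le pi_pos.le]
    intro x hx y hy hxy
    have := antitoneOn_cos hx hy hxy
    simp only
    gcongr
  · intro θ _
    rw [uIcc_of_le (by linarith)]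
    constructor <;> nlinarith [neg_one_le_cos θ, cos_le_one θ]

theorem LocSobolev.integral_iteratedDeriv_smul {f : ℝ → ℂ} {m : ℕ} (hf : LocSobolev m f) {r : ℝ}
    (hr0 : 0 < r) (hr1 : r < 1) (n : ℕ) :
    r ^ m • ∫ θ in (0 : ℝ)..π, (sin θ ^ (2 * m) * chebT n m (cos θ)) •
        iteratedDeriv m f (1 + r * cos θ) =
      lam m n • ∫ θ in (0 : ℝ)..π, cos (n * θ) • f (1 + r * cos θ) := by
  suffices hk : ∀ k ≤ m, r ^ k • ∫ θ in (0 : ℝ)..π, (sin θ ^ (2 * k) * chebT n k (cos θ)) •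
      iteratedDeriv k f (1 + r * cos θ) =
      lam k n • ∫ θ in (0 : ℝ)..π, cos (n * θ) • f (1 + r * cos θ) from hk m le_rfl
  intro k
  induction k with
  | zero => simp [lam, chebT_zero_cos]
  | succ k ih =>
    intro hk
    have hderiv : ∀ θ ∈ Ioo 0 π, deriv (fun t => iteratedDeriv k f (1 + r * cos t)) θ =
        (r * -sin θ) • iteratedDeriv (k + 1) f (1 + r * cos θ) := fun θ hθ => by
      rw [deriv_comp_of_hasStrictDerivAt (φ := fun t => 1 + r * cos t)
        (((hasStrictDerivAt_cos θ).const_mul r).const_add 1)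
        (mul_ne_zero hr0.ne' (neg_ne_zero.2 (sin_pos_of_mem_Ioo hθ).ne')), iteratedDeriv_succ]
    rw [pow_succ, mul_smul,
      integral_mul_chebT_succ n k (hf.absolutelyContinuous_comp_cos hk hr0 hr1) hderiv, lam_succ,
      mul_smul, smul_comm, ih (by lia), smul_comm]

/-! ### Decay of the Chebyshev coefficients -/

theorem one_add_cos_mem_Ioo {θ : ℝ} (hθ : θ ∈ Ioo 0 π) : 1 + cos θ ∈ Ioo (0 : ℝ) 2 := by
  have h₁ : -1 < cos θ := by simpa using cos_lt_cos_of_nonneg_of_le_pi hθ.1.le le_rfl hθ.2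
  have h₂ : cos θ < 1 := by simpa using cos_lt_cos_of_nonneg_of_le_pi le_rfl hθ.2.le hθ.1
  constructor <;> linarith

theorem one_add_mul_cos_mem_Icc {r : ℝ} (hr : r ∈ Icc (0 : ℝ) 1) (θ : ℝ) :
    1 + r * cos θ ∈ Icc (0 : ℝ) 2 := by
  constructor <;> nlinarith [neg_one_le_cos θ, cos_le_one θ, hr.1, hr.2]

theorem one_add_cos_mem_Icc (θ : ℝ) : 1 + cos θ ∈ Icc (0 : ℝ) 2 := by
  simpa using one_add_mul_cos_mem_Icc (right_mem_Icc.2 zero_le_one) θ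

theorem image_one_add_cos : (fun θ => 1 + cos θ) '' Ioo 0 π = Ioo (0 : ℝ) 2 := by
  refine subset_antisymm (image_subset_iff.2 fun θ => one_add_cos_mem_Ioo) fun s hs =>
    ⟨arccos (s - 1), ⟨arccos_pos.2 (by linarith [hs.2]), ?_⟩, ?_⟩
  · refine (arccos_le_pi _).lt_of_ne fun h => ?_
    linarith [arccos_eq_pi.1 h, hs.1]
  · simp only
    rw [cos_arccos (by linarith [hs.1]) (by linarith [hs.2])]
    ring

theorem lintegral_image_one_add_mul_cos {r : ℝ} (hr : 0 ≤ r) (h : ℝ → ℝ≥0∞) :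
    ∫⁻ s in (fun θ => 1 + r * cos θ) '' Ioo 0 π, h s =
      ∫⁻ θ in Ioo 0 π, ENNReal.ofReal (r * sin θ) * h (1 + r * cos θ) := by
  rw [lintegral_image_eq_lintegral_deriv_mul_of_antitoneOn (f' := fun θ => r * -sin θ)
    measurableSet_Ioo]
  · simp
  · exact fun θ _ => (((hasDerivAt_cos θ).const_mul r).const_add 1).hasDerivWithinAt
  · intro x hx y hy hxy
    have := antitoneOn_cos (Ioo_subset_Icc_self hx) (Ioo_subset_Icc_self hy) hxy
    simp only
    gcongr

theorem mul_rpow_sub_half {t : ℝ} (ht : 0 < t) (m : ℕ) :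
    t * (t ^ 2) ^ ((m : ℝ) - 1 / 2) = t ^ (2 * m) := by
  nth_rw 1 [← rpow_one t]
  rw [← rpow_natCast t 2, ← rpow_mul ht.le, ← rpow_add ht, ← rpow_natCast t (2 * m)]
  push_cast
  ring_nf

theorem sin_mul_rho {θ : ℝ} (hθ : θ ∈ Ioo 0 π) (m : ℕ) :
    sin θ * rho m (1 + cos θ) = sin θ ^ (2 * m) := by
  rw [← mul_rpow_sub_half (sin_pos_of_mem_Ioo hθ), rho, sin_sq]
  ring_nf

theorem le_mul_sin_mul_rho {r θ : ℝ} (hr : r ∈ Ioc (0 : ℝ) 1) (hθ : θ ∈ Ioo 0 π) {m : ℕ}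
    (hm : 1 ≤ m) : (r * sin θ) ^ (2 * m) ≤ r * sin θ * rho m (1 + r * cos θ) := by
  obtain ⟨hr0, hr1⟩ := hr
  have hsin := sin_pos_of_mem_Ioo hθ
  have hbase : (r * sin θ) ^ 2 ≤ (1 + r * cos θ) * (2 - (1 + r * cos θ)) := by
    rw [mul_pow, sin_sq]
    nlinarith
  have hexp : (0 : ℝ) ≤ m - 1 / 2 := by
    have : (1 : ℝ) ≤ m := mod_cast hm
    linarith
  rw [← mul_rpow_sub_half (by positivity), rho]
  gcongr

theorem rhoNorm_sq_eq_lintegral (m : ℕ) (g : ℝ → ℂ) :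
    rhoNorm m g ^ 2 = ∫⁻ s in Ioo (0 : ℝ) 2, ‖g s‖ₑ ^ 2 * ENNReal.ofReal (rho m s) := by
  rw [rhoNorm, ← ENNReal.rpow_natCast, ← ENNReal.rpow_mul]
  norm_num

theorem rhoNorm_sq (m : ℕ) (g : ℝ → ℂ) :
    rhoNorm m g ^ 2 =
      ∫⁻ θ in Ioo 0 π, ‖g (1 + cos θ)‖ₑ ^ 2 * ENNReal.ofReal (sin θ ^ (2 * m)) := by
  have hsubst := lintegral_image_one_add_mul_cos zero_le_one
    fun s => ‖g s‖ₑ ^ 2 * ENNReal.ofReal (rho m s)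
  simp only [one_mul] at hsubst
  rw [rhoNorm_sq_eq_lintegral, ← image_one_add_cos, hsubst]
  refine setLIntegral_congr_fun measurableSet_Ioo fun θ hθ => ?_
  rw [← sin_mul_rho hθ, ENNReal.ofReal_mul (sin_pos_of_mem_Ioo hθ).le]
  ring

theorem lintegral_comp_one_add_mul_cos_le_rhoNorm_sq {r : ℝ} (hr : r ∈ Ioc (0 : ℝ) 1) {m : ℕ}
    (hm : 1 ≤ m) (g : ℝ → ℂ) :
    ∫⁻ θ in Ioo 0 π, ‖g (1 + r * cos θ)‖ₑ ^ 2 * ENNReal.ofReal ((r * sin θ) ^ (2 * m)) ≤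
      rhoNorm m g ^ 2 := by
  calc _ ≤ ∫⁻ θ in Ioo 0 π, ENNReal.ofReal (r * sin θ) *
        (‖g (1 + r * cos θ)‖ₑ ^ 2 * ENNReal.ofReal (rho m (1 + r * cos θ))) := by
        refine setLIntegral_mono' measurableSet_Ioo fun θ hθ => ?_
        rw [mul_left_comm, ← ENNReal.ofReal_mul (mul_pos hr.1 (sin_pos_of_mem_Ioo hθ)).le]
        gcongr
        exact le_mul_sin_mul_rho hr hθ hm
    _ = ∫⁻ s in (fun θ => 1 + r * cos θ) '' Ioo 0 π, ‖g s‖ₑ ^ 2 * ENNReal.ofReal (rho m s) :=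
        (lintegral_image_one_add_mul_cos hr.1.le
          fun s => ‖g s‖ₑ ^ 2 * ENNReal.ofReal (rho m s)).symm
    _ ≤ rhoNorm m g ^ 2 := by
        rw [rhoNorm_sq_eq_lintegral]
        refine lintegral_mono_set (image_subset_iff.2 fun θ hθ => ?_)
        have := one_add_cos_mem_Ioo hθ
        constructor <;> nlinarith [this.1, this.2, hr.1, hr.2]

theorem sum_enorm_integral_smul_sq_le {Ω ι : Type*} [MeasurableSpace Ω] {μ : Measure Ω}
    [DecidableEq ι] {ψ : ι → Ω → ℝ} (hψ : ∀ i, MemLp (ψ i) 2 μ)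
    (horth : ∀ i j, ∫ x, ψ i x * ψ j x ∂μ = if i = j then 1 else 0) {G : Ω → ℂ}
    (hG : AEStronglyMeasurable G μ) (S : Finset ι) :
    ∑ i ∈ S, ‖∫ x, ψ i x • G x ∂μ‖ₑ ^ 2 ≤ ∫⁻ x, ‖G x‖ₑ ^ 2 ∂μ := by
  have hnorm : eLpNorm G 2 μ ^ 2 = ∫⁻ x, ‖G x‖ₑ ^ 2 ∂μ := by
    simpa using eLpNorm_nnreal_pow_eq_lintegral (f := G) (μ := μ) (p := 2) two_ne_zero
  rcases eq_or_ne (eLpNorm G 2 μ) ∞ with htop | hfin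
  · simp [← hnorm, htop]
  have hG2 : MemLp G 2 μ := ⟨hG, hfin.lt_top⟩
  have hψ2 (i : ι) : MemLp (fun x => (ψ i x : ℂ)) 2 μ := (hψ i).ofReal
  have hv : Orthonormal ℂ fun i => (hψ2 i).toLp := by
    refine orthonormal_iff_ite.2 fun i j => ?_
    rw [L2.inner_def]
    calc _ = ∫ x, ((ψ i x * ψ j x : ℝ) : ℂ) ∂μ := by
          refine integral_congr_ae ?_
          filter_upwards [(hψ2 i).coeFn_toLp, (hψ2 j).coeFn_toLp] with x hi hj
          simp [hi, hj, mul_comm]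
      _ = _ := by rw [integral_complex_ofReal, horth]; split_ifs <;> simp
  have hcoef (i : ι) : inner ℂ (hψ2 i).toLp hG2.toLp = ∫ x, ψ i x • G x ∂μ := by
    rw [L2.inner_def]
    refine integral_congr_ae ?_
    filter_upwards [(hψ2 i).coeFn_toLp, hG2.coeFn_toLp] with x hi hx
    simp [hi, hx, mul_comm]
  have hbessel := ENNReal.ofReal_le_ofReal (hv.sum_inner_products_le (s := S) hG2.toLp)
  simp only [hcoef] at hbessel
  rw [ENNReal.ofReal_sum_of_nonneg fun _ _ => by positivity] at hbessel
  simpa only [ENNReal.ofReal_pow (norm_nonneg _), ofReal_norm, Lp.enorm_toLp, hnorm] using hbessel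

theorem lam_pos {m n : ℕ} (hn : m ≤ n) : 0 < lam m n :=
  Finset.prod_pos fun j hj => by
    have : (j : ℝ) < n := mod_cast (Finset.mem_range.1 hj).trans_le hn
    nlinarith [j.cast_nonneg (α := ℝ)]

theorem pow_le_pow_mul_lam {m n : ℕ} (hn : m ≤ n) :
    (n : ℝ) ^ (2 * m) ≤ (m : ℝ) ^ m * lam m n := by
  have hfactor : ∀ j ∈ Finset.range m, (n : ℝ) ^ 2 ≤ m * ((n : ℝ) ^ 2 - (j : ℝ) ^ 2) := by
    intro j hj
    have hj' : (j : ℝ) + 1 ≤ m := mod_cast Finset.mem_range.1 hj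
    have hn' : (m : ℝ) ≤ n := mod_cast hn
    have hj0 : (0 : ℝ) ≤ j := j.cast_nonneg
    have hjm : (m : ℝ) * j ≤ n ^ 2 := by nlinarith
    nlinarith [mul_le_mul_of_nonneg_right hjm hj0, sq_nonneg (n : ℝ)]
  calc (n : ℝ) ^ (2 * m) = ∏ _j ∈ Finset.range m, (n : ℝ) ^ 2 := by
        rw [Finset.prod_const, Finset.card_range, pow_mul]
    _ ≤ ∏ j ∈ Finset.range m, m * ((n : ℝ) ^ 2 - (j : ℝ) ^ 2) :=
        Finset.prod_le_prod (fun _ _ => by positivity) hfactor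
    _ = (m : ℝ) ^ m * lam m n := by
        rw [Finset.prod_mul_distrib, Finset.prod_const, Finset.card_range, lam]

theorem intervalIntegral_zero_pi {E : Type*} [NormedAddCommGroup E] [NormedSpace ℝ E]
    (u : ℝ → E) : ∫ θ in (0 : ℝ)..π, u θ = ∫ θ in Ioo 0 π, u θ := by
  rw [intervalIntegral.integral_of_le pi_pos.le, integral_Ioc_eq_integral_Ioo]

/-- The functions `sin^m θ T_n^{(m)}(cos θ)` with `m ≤ n`, normalised in `L²(0, π)`. -/
def chebOrtho (m n : ℕ) (θ : ℝ) : ℝ :=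
  √(2 / (π * lam m n)) * (sin θ ^ m * chebT n m (cos θ))

theorem memLp_chebOrtho (m n : ℕ) : MemLp (chebOrtho m n) 2 (volume.restrict (Ioo 0 π)) := by
  have hcont : Continuous (chebOrtho m n) :=
    continuous_const.mul ((continuous_sin.pow m).mul
      ((contDiff_chebT n m).continuous.comp continuous_cos))
  exact (memLp_two_iff_integrable_sq hcont.aestronglyMeasurable).2
    ((hcont.pow 2).integrableOn_Icc.mono_set Ioo_subset_Icc_self)

theorem integral_chebOrtho_mul_chebOrtho {m n n' : ℕ} (hm : 1 ≤ m) (hn : m ≤ n) :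
    ∫ θ in Ioo 0 π, chebOrtho m n θ * chebOrtho m n' θ = if n = n' then 1 else 0 := by
  have hscale : ∫ θ in Ioo 0 π, chebOrtho m n θ * chebOrtho m n' θ =
      √(2 / (π * lam m n)) * √(2 / (π * lam m n')) *
        (lam m n * ∫ θ in (0 : ℝ)..π, cos (n * θ) * cos (n' * θ)) := by
    rw [← integral_chebT_mul_chebT, ← intervalIntegral.integral_const_mul, intervalIntegral_zero_pi]
    congr with θ
    simp only [chebOrtho]
    ring
  split_ifs with h
  · subst h
    have hlam := lam_pos hn
    rw [hscale, integral_cos_mul_cos, mul_self_sqrt (by positivity), if_pos (sub_self _),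
      if_neg (by lia)]
    field_simp
    simp
  · rw [hscale, isOrthoSystem_cos.orthogonal n n' h, mul_zero, mul_zero]

theorem measurable_iteratedDeriv_of_pos {F : Type*} [NormedAddCommGroup F] [NormedSpace ℝ F]
    [CompleteSpace F] [MeasurableSpace F] [BorelSpace F] {m : ℕ} (hm : 1 ≤ m) (f : ℝ → F) :
    Measurable (iteratedDeriv m f) := by
  obtain ⟨k, rfl⟩ := Nat.exists_eq_add_of_le' hm
  rw [iteratedDeriv_succ]
  exact measurable_deriv _

theorem LocSobolev.enorm_integral_chebOrtho_sq {f : ℝ → ℂ} {m n : ℕ} (hf : LocSobolev m f) {r : ℝ}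
    (hr0 : 0 < r) (hr1 : r < 1) (hn : m ≤ n) :
    ‖∫ θ in Ioo 0 π, chebOrtho m n θ • ((r * sin θ) ^ m • iteratedDeriv m f (1 + r * cos θ))‖ₑ ^ 2 =
      ENNReal.ofReal (2 / π * lam m n) *
        ‖∫ θ in (0 : ℝ)..π, cos (n * θ) • f (1 + r * cos θ)‖ₑ ^ 2 := by
  have hlam := lam_pos hn
  have hint : ∫ θ in Ioo 0 π,
        chebOrtho m n θ • ((r * sin θ) ^ m • iteratedDeriv m f (1 + r * cos θ)) =
      (√(2 / (π * lam m n)) * lam m n) •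
        ∫ θ in (0 : ℝ)..π, cos (n * θ) • f (1 + r * cos θ) := by
    rw [mul_smul, ← hf.integral_iteratedDeriv_smul hr0 hr1, smul_smul,
      ← intervalIntegral.integral_smul, intervalIntegral_zero_pi]
    congr with θ
    simp only [chebOrtho, smul_smul]
    ring_nf
  rw [hint, enorm_smul, mul_pow, Real.enorm_of_nonneg (by positivity),
    ← ENNReal.ofReal_pow (by positivity), mul_pow, sq_sqrt (by positivity)]
  congr 2
  field_simp

theorem LocSobolev.sum_lam_mul_enorm_sq_le_of_lt_one {f : ℝ → ℂ} {m : ℕ} (hm : 1 ≤ m)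
    (hf : LocSobolev m f) {r : ℝ} (hr0 : 0 < r) (hr1 : r < 1) (S : Finset {n // m ≤ n}) :
    ∑ n ∈ S, ENNReal.ofReal (2 / π * lam m n) *
        ‖∫ θ in (0 : ℝ)..π, cos (n * θ) • f (1 + r * cos θ)‖ₑ ^ 2 ≤
      rhoNorm m (iteratedDeriv m f) ^ 2 := by
  set G : ℝ → ℂ := fun θ => (r * sin θ) ^ m • iteratedDeriv m f (1 + r * cos θ)
  have hG : Measurable G :=
    (by fun_prop : Continuous fun θ => (r * sin θ) ^ m).measurable.smul
      ((measurable_iteratedDeriv_of_pos hm f).comp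
        (by fun_prop : Continuous fun θ => 1 + r * cos θ).measurable)
  have hbessel := sum_enorm_integral_smul_sq_le (ψ := fun n : {n // m ≤ n} => chebOrtho m n)
    (fun n => memLp_chebOrtho m n)
    (fun n n' => by simp only [integral_chebOrtho_mul_chebOrtho hm n.2, Subtype.ext_iff])
    hG.aestronglyMeasurable S
  simp only [G, hf.enorm_integral_chebOrtho_sq hr0 hr1 (Subtype.property _)] at hbessel
  refine hbessel.trans (le_trans (lintegral_mono fun θ => le_of_eq ?_)
    (lintegral_comp_one_add_mul_cos_le_rhoNorm_sq ⟨hr0, hr1.le⟩ hm _))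
  rw [enorm_smul, mul_pow, mul_comm, ← enorm_pow (_ ^ m), ← pow_mul, mul_comm m,
    Real.enorm_of_nonneg ((even_two_mul m).pow_nonneg _)]

theorem continuousOn_integral_cos_smul {f : ℝ → ℂ} (hf : ContinuousOn f (Icc 0 2)) (n : ℕ) :
    ContinuousOn (fun r : ℝ => ∫ θ in (0 : ℝ)..π, cos (n * θ) • f (1 + r * cos θ)) (Icc 0 1) := by
  rw [continuousOn_iff_continuous_domRestrict]
  refine intervalIntegral.continuous_parametric_intervalIntegral_of_continuous'
    (f := fun (r : Icc (0 : ℝ) 1) θ => cos (n * θ) • f (1 + r * cos θ)) ?_ _ _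
  have hcos : Continuous fun p : Icc (0 : ℝ) 1 × ℝ => cos (n * p.2) := by fun_prop
  have hpoint : Continuous fun p : Icc (0 : ℝ) 1 × ℝ => 1 + p.1 * cos p.2 := by fun_prop
  exact hcos.smul (hf.comp_continuous hpoint fun p => one_add_mul_cos_mem_Icc p.1.2 p.2)

/-- The `n`-th coefficient of the cosine series of an even `2π`-periodic function. -/
def cosCoeff (F : ℝ → ℂ) (n : ℕ) : ℂ :=
  (if n = 0 then π⁻¹ else 2 / π) • ∫ θ in (0 : ℝ)..π, cos (n * θ) • F θ

/-- The `n`-th Chebyshev coefficient of `f` on `[0, 2]`: a cosine coefficient under the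
substitution `s = 1 + cos θ`. -/
def chebCoeff (f : ℝ → ℂ) : ℕ → ℂ := cosCoeff fun θ => f (1 + cos θ)

theorem LocSobolev.tsum_lam_mul_enorm_sq_le {f : ℝ → ℂ} {m : ℕ} (hm : 1 ≤ m)
    (hf : LocSobolev m f) :
    ∑' n : {n // m ≤ n}, ENNReal.ofReal (2 / π * lam m n) *
        ‖∫ θ in (0 : ℝ)..π, cos (n * θ) • f (1 + cos θ)‖ₑ ^ 2 ≤
      rhoNorm m (iteratedDeriv m f) ^ 2 := by
  rw [ENNReal.tsum_eq_iSup_sum]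
  refine iSup_le fun S => ?_
  have hcont : ContinuousOn (fun r : ℝ => ∑ n ∈ S, ENNReal.ofReal (2 / π * lam m n) *
      ‖∫ θ in (0 : ℝ)..π, cos ((n : ℕ) * θ) • f (1 + r * cos θ)‖ₑ ^ 2) (Icc 0 1) := by
    refine continuousOn_finsetSum _ fun n _ => ?_
    exact (ENNReal.continuous_const_mul ENNReal.ofReal_ne_top).comp_continuousOn
      ((ENNReal.continuous_pow 2).comp_continuousOn
        (continuousOn_integral_cos_smul hf.continuousOn n).enorm)
  have hlim := (hcont.continuousWithinAt (right_mem_Icc.2 zero_le_one)).mono Ioo_subset_Icc_self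
  have : (𝓝[Ioo (0 : ℝ) 1] 1).NeBot := right_nhdsWithin_Ioo_neBot one_pos
  simp only [ContinuousWithinAt, one_mul] at hlim
  exact le_of_tendsto hlim (eventually_mem_nhdsWithin.mono fun r hr =>
    hf.sum_lam_mul_enorm_sq_le_of_lt_one hm hr.1 hr.2 S)

/-- The sequence `a` with its terms of index at most `L` replaced by zero. -/
def tail (L : ℕ) (a : ℕ → ℂ) : ℕ → ℂ := (Ioi L).indicator a

theorem tail_of_le {L n : ℕ} (a : ℕ → ℂ) (h : n ≤ L) : tail L a n = 0 :=
  indicator_of_notMem (notMem_Ioi.2 h) a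

theorem pow_mul_enorm_chebCoeff_sq_le (f : ℝ → ℂ) {m n : ℕ} (hn0 : n ≠ 0) (hn : m ≤ n) :
    (n : ℝ≥0∞) ^ (2 * m) * ‖chebCoeff f n‖ₑ ^ 2 ≤
      (m : ℝ≥0∞) ^ m * (ENNReal.ofReal (2 / π * lam m n) *
        ‖∫ θ in (0 : ℝ)..π, cos (n * θ) • f (1 + cos θ)‖ₑ ^ 2) := by
  have hconst : (n : ℝ) ^ (2 * m) * (2 / π) ^ 2 ≤ (m : ℝ) ^ m * (2 / π * lam m n) := by
    have hpi : 2 / π ≤ 1 := (div_le_one pi_pos).2 two_le_pi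
    calc _ ≤ (m : ℝ) ^ m * lam m n * (2 / π * 1) := by
          rw [sq]
          have := (lam_pos hn).le
          gcongr
          exact pow_le_pow_mul_lam hn
      _ = _ := by ring
  rw [chebCoeff, cosCoeff, if_neg hn0, enorm_smul, mul_pow, ← mul_assoc, ← mul_assoc,
    Real.enorm_of_nonneg (by positivity), ← ENNReal.ofReal_natCast n, ← ENNReal.ofReal_natCast m,
    ← ENNReal.ofReal_pow (by positivity), ← ENNReal.ofReal_pow (by positivity),
    ← ENNReal.ofReal_pow (by positivity), ← ENNReal.ofReal_mul (by positivity),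
    ← ENNReal.ofReal_mul (by positivity)]
  exact mul_le_mul_left (ENNReal.ofReal_le_ofReal hconst) _

theorem LocSobolev.tsum_pow_mul_enorm_tail_sq_le {f : ℝ → ℂ} {m L : ℕ} (hm : 1 ≤ m)
    (hmL : m ≤ L + 1) (hf : LocSobolev m f) :
    ∑' n : ℕ, (n : ℝ≥0∞) ^ (2 * m) * ‖tail L (chebCoeff f) n‖ₑ ^ 2 ≤
      (m : ℝ≥0∞) ^ m * rhoNorm m (iteratedDeriv m f) ^ 2 := by
  have hsupp : (Function.support fun n : ℕ =>
      (n : ℝ≥0∞) ^ (2 * m) * ‖tail L (chebCoeff f) n‖ₑ ^ 2) ⊆ {n | m ≤ n} := fun n hn => by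
    by_contra h
    rw [mem_ofPred_eq, not_le] at h
    exact hn (by simp [tail_of_le (chebCoeff f) (show n ≤ L by lia)])
  rw [← tsum_subtype_eq_of_support_subset hsupp]
  refine le_trans ?_ (mul_le_mul_right (hf.tsum_lam_mul_enorm_sq_le hm) _)
  rw [← ENNReal.tsum_mul_left]
  refine ENNReal.tsum_le_tsum fun ⟨n, hn⟩ => le_trans ?_
    (pow_mul_enorm_chebCoeff_sq_le (n := n) f (Nat.one_le_iff_ne_zero.1 (hm.trans hn)) hn)
  gcongr
  exact enorm_indicator_le_enorm_self _ _

/-! ### Chebyshev expansion and aliasing -/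

instance : Fact (0 < 2 * π) := ⟨two_pi_pos⟩

theorem fourierCoeff_lift_of_even {F : ℝ → ℂ} (hF : Continuous F) (heven : Function.Even F)
    (hper : Function.Periodic F (2 * π)) (n : ℤ) :
    fourierCoeff (T := 2 * π) hper.lift n = π⁻¹ • ∫ θ in (0 : ℝ)..π, cos (n * θ) • F θ := by
  set h : ℝ → ℂ := fun x => Complex.exp (-(n * x) * Complex.I) * F x with hh
  have hcont : Continuous h := by fun_prop
  have hcontneg : Continuous fun x => h (-x) := by fun_prop
  have hfourier (x : ℝ) : fourier (-n) (x : AddCircle (2 * π)) • hper.lift x = h x := by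
    rw [hper.lift_coe, fourier_coe_apply, smul_eq_mul, hh]
    congr 2
    push_cast
    field_simp
  have hfold (x : ℝ) : h (-x) + h x = (2 : ℝ) • (cos (n * x) • F x) := by
    simp only [hh, heven x, Complex.real_smul]
    push_cast
    rw [Complex.cos]
    ring_nf
  have hreflect : ∫ x in (-π)..0, h x = ∫ x in (0 : ℝ)..π, h (-x) := by
    rw [intervalIntegral.integral_comp_neg fun x => h x, neg_zero]
  rw [fourierCoeff_eq_intervalIntegral _ n (-π), show -π + 2 * π = π by ring]
  simp_rw [hfourier]
  rw [← intervalIntegral.integral_add_adjacent_intervals (b := 0) (hcont.intervalIntegrable _ _)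
    (hcont.intervalIntegrable _ _), hreflect, ← intervalIntegral.integral_add
    (hcontneg.intervalIntegrable _ _) (hcont.intervalIntegrable _ _)]
  simp_rw [hfold]
  rw [intervalIntegral.integral_smul, smul_smul]
  congr 1
  field_simp

theorem fourier_coe_add_fourier_coe_neg (n : ℤ) (θ : ℝ) :
    fourier n (θ : AddCircle (2 * π)) + fourier (-n) (θ : AddCircle (2 * π)) =
      2 * (cos (n * θ) : ℂ) := by
  have hfreq (k : ℤ) :
      2 * π * Complex.I * k * θ / ((2 * π : ℝ) : ℂ) = k * θ * Complex.I := by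
    push_cast
    field_simp
  rw [fourier_coe_apply, fourier_coe_apply, hfreq, hfreq, Complex.ofReal_cos, Complex.cos]
  push_cast
  ring_nf

theorem hasSum_cosCoeff {F : ℝ → ℂ} (hF : Continuous F) (heven : Function.Even F)
    (hper : Function.Periodic F (2 * π)) (hs : Summable (cosCoeff F)) (θ : ℝ) :
    HasSum (fun n : ℕ => cosCoeff F n * (cos (n * θ) : ℂ)) (F θ) := by
  set I : ℕ → ℂ := fun n => π⁻¹ • ∫ θ in (0 : ℝ)..π, cos (n * θ) • F θ with hI
  set G : C(AddCircle (2 * π), ℂ) := ⟨hper.lift, continuous_quot_lift _ hF⟩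
  have hcoeff (n : ℤ) : fourierCoeff G n = I n.natAbs := by
    refine (fourierCoeff_lift_of_even hF heven hper n).trans ?_
    rcases Int.natAbs_eq n with h | h <;> rw [hI, h] <;> simp
  have hcos : cosCoeff F = fun n => (if n = 0 then 1 else 2) * I n := by
    ext n
    simp only [cosCoeff, hI, Complex.real_smul]
    split_ifs <;> push_cast <;> ring
  have hsI : Summable I := by
    refine (hs.norm.of_norm_bounded fun n => ?_)
    rw [hcos, norm_mul]
    refine le_mul_of_one_le_left (norm_nonneg _) ?_
    split_ifs <;> simp
  have hsum : Summable (fourierCoeff G) := by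
    refine Summable.of_nat_of_neg ?_ ?_ <;> simpa [hcoeff] using hsI
  have hpair := (has_pointwise_sum_fourier_series_of_summable hsum
    (θ : AddCircle (2 * π))).nat_add_neg.sub (hasSum_ite_eq 0 (I 0))
  have hval : G (θ : AddCircle (2 * π)) +
      fourierCoeff G 0 • fourier 0 (θ : AddCircle (2 * π)) - I 0 = F θ := by
    simp only [hcoeff, Int.natAbs_zero, fourier_zero, smul_eq_mul, mul_one, add_sub_cancel_right]
    exact hper.lift_coe θ
  rw [hval] at hpair
  refine (congrArg (HasSum · (F θ)) (funext fun n => ?_)).mpr hpair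
  simp only [hcoeff, hcos, smul_eq_mul, Int.natAbs_neg, Int.natAbs_natCast, ← mul_add,
    Int.cast_natCast, fourier_coe_add_fourier_coe_neg]
  split_ifs with hn
  · subst hn
    simp
    ring
  · ring

theorem hasSum_chebCoeff {f : ℝ → ℂ} (hf : ContinuousOn f (Icc 0 2))
    (hs : Summable (chebCoeff f)) (θ : ℝ) :
    HasSum (fun n : ℕ => chebCoeff f n * (cos (n * θ) : ℂ)) (f (1 + cos θ)) :=
  hasSum_cosCoeff (hf.comp_continuous (by fun_prop) one_add_cos_mem_Icc)
    (fun x => by simp) (fun x => by simp) hs θ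

/-- The frequency in `{0, …, L}` whose cosine is an alias of the `n`-th one: both agree at the
points `l π / L`. -/
def aliasIndex (L n : ℕ) : ℕ := if Even (n / L) then n % L else L - n % L

theorem aliasIndex_le {L : ℕ} (hL : 1 ≤ L) (n : ℕ) : aliasIndex L n ≤ L := by
  have := Nat.mod_lt n hL
  unfold aliasIndex
  split_ifs <;> omega

theorem aliasIndex_of_le {L n : ℕ} (hL : 1 ≤ L) (h : n ≤ L) : aliasIndex L n = n := by
  rcases h.lt_or_eq with h | rfl
  · simp [aliasIndex, Nat.div_eq_of_lt h, Nat.mod_eq_of_lt h]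
  · simp [aliasIndex, Nat.div_self hL]

theorem aliasIndex_block_injective {L : ℕ} (k : ℕ) :
    Function.Injective fun j : Fin L => aliasIndex L (k * L + j) := by
  rintro ⟨i, hi⟩ ⟨j, hj⟩ h
  have hdiv {i : ℕ} (hi : i < L) : (k * L + i) / L = k := by
    rw [mul_comm, Nat.mul_add_div (by omega), Nat.div_eq_of_lt hi, add_zero]
  have hmod {i : ℕ} (hi : i < L) : (k * L + i) % L = i := by
    rw [mul_comm, Nat.mul_add_mod, Nat.mod_eq_of_lt hi]
  simp only [aliasIndex, hdiv hi, hmod hi, hdiv hj, hmod hj] at h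
  rw [Fin.mk.injEq]
  split_ifs at h <;> omega

theorem cos_aliasIndex {L : ℕ} (hL : 1 ≤ L) (n l : ℕ) :
    cos (aliasIndex L n * (l * π / L)) = cos (n * (l * π / L)) := by
  have hn : (n : ℝ) = L * (n / L : ℕ) + (n % L : ℕ) := mod_cast (Nat.div_add_mod n L).symm
  unfold aliasIndex
  split_ifs with h
  · obtain ⟨t, ht⟩ := h
    rw [hn, ht, ← cos_add_nat_mul_two_pi _ (t * l)]
    congr 1
    push_cast
    field_simp
    ring
  · obtain ⟨t, ht⟩ := Nat.not_even_iff_odd.1 h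
    rw [hn, ht, ← cos_neg, ← cos_add_nat_mul_two_pi _ ((t + 1) * l),
      Nat.cast_sub (Nat.mod_lt n hL).le]
    congr 1
    push_cast
    field_simp
    ring

theorem injOn_node (L : ℕ) :
    InjOn (fun l => (node L l : ℂ)) (Finset.range (L + 1) : Finset ℕ) := by
  intro i hi j hj h
  exact (Polynomial.Chebyshev.strictAntiOn_node L).injOn hi hj
    (add_left_cancel (Complex.ofReal_injective h))

theorem interpolant_of_cos {L : ℕ} (hL : 1 ≤ L) (n : ℕ) {f : ℝ → ℂ}
    (hf : ∀ θ : ℝ, f (1 + cos θ) = cos (n * θ)) :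
    interpolant L f =
      (Polynomial.Chebyshev.T ℂ (aliasIndex L n)).comp (Polynomial.X - Polynomial.C 1) := by
  refine (Lagrange.eq_interpolate_of_eval_eq _ (injOn_node L) ?_ fun l _ => ?_).symm
  · refine Polynomial.degree_le_natDegree.trans_lt ?_
    rw [Finset.card_range, Polynomial.natDegree_comp, Polynomial.natDegree_X_sub_C, mul_one,
      Polynomial.Chebyshev.natDegree_T]
    exact mod_cast Nat.lt_succ_of_le (aliasIndex_le hL n)
  · rw [node, hf, ← cos_aliasIndex hL]
    simp [Polynomial.Chebyshev.T_complex_cos]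

theorem eval_interpolant (L : ℕ) (f : ℝ → ℂ) (z : ℂ) :
    (interpolant L f).eval z = ∑ l ∈ Finset.range (L + 1), f (node L l) *
      (Lagrange.basis (Finset.range (L + 1)) (fun l => (node L l : ℂ)) l).eval z := by
  simp [interpolant, Lagrange.interpolate_apply, Polynomial.eval_finsetSum]

theorem sum_cos_mul_basis {L : ℕ} (hL : 1 ≤ L) (n : ℕ) (θ : ℝ) :
    ∑ l ∈ Finset.range (L + 1), (cos (n * (l * π / L)) : ℂ) *
      (Lagrange.basis (Finset.range (L + 1)) (fun l => (node L l : ℂ)) l).eval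
        ((1 + cos θ : ℝ) : ℂ) = cos (aliasIndex L n * θ) := by
  have hcos (θ : ℝ) : (chebT n 0 (1 + cos θ - 1) : ℂ) = cos (n * θ) := by
    rw [add_sub_cancel_left, chebT_zero_cos]
  have heval := eval_interpolant L (fun s => (chebT n 0 (s - 1) : ℂ)) ((1 + cos θ : ℝ) : ℂ)
  rw [interpolant_of_cos hL n hcos] at heval
  simp only [node, hcos] at heval ⊢
  rw [← heval]
  simp [Polynomial.Chebyshev.T_complex_cos]

theorem hasSum_interpError {L : ℕ} (hL : 1 ≤ L) {f : ℝ → ℂ} {a : ℕ → ℂ}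
    (hf : ∀ θ : ℝ, HasSum (fun n : ℕ => a n * (cos (n * θ) : ℂ)) (f (1 + cos θ))) (θ : ℝ) :
    HasSum (fun n : ℕ => tail L a n * ((cos (n * θ) : ℂ) - cos (aliasIndex L n * θ)))
      (interpError L f (1 + cos θ)) := by
  have hinterp : HasSum (fun n : ℕ => a n * (cos (aliasIndex L n * θ) : ℂ))
      ((interpolant L f).eval ((1 + cos θ : ℝ) : ℂ)) := by
    rw [eval_interpolant]
    simp_rw [← sum_cos_mul_basis hL, Finset.mul_sum, ← mul_assoc]
    exact hasSum_sum fun l _ => (hf _).mul_right _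
  refine (congrArg (HasSum · (interpError L f (1 + cos θ))) (funext fun n => ?_)).mpr
    ((hf θ).sub hinterp)
  rw [← mul_sub]
  rcases le_or_gt n L with h | h
  · rw [aliasIndex_of_le hL h, sub_self, mul_zero, mul_zero]
  · rw [tail, indicator_of_mem (mem_Ioi.2 h)]

/-! ### Mean-square bounds -/

theorem enorm_sub_sq_le {E : Type*} [SeminormedAddCommGroup E] (x y : E) :
    ‖x - y‖ₑ ^ 2 ≤ 2 * (‖x‖ₑ ^ 2 + ‖y‖ₑ ^ 2) := by
  refine (pow_le_pow_left' enorm_sub_le 2).trans ?_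
  have h := ENNReal.rpow_add_le_mul_rpow_add_rpow ‖x‖ₑ ‖y‖ₑ one_le_two
  norm_num at h
  exact h

theorem IsOrthoSystem.lintegral_aliased_sq_le {φ : ℕ → ℝ → ℝ} (hφ : IsOrthoSystem φ)
    (hφ1 : ∀ n θ, |φ n θ| ≤ 1) {L : ℕ} (hL : 1 ≤ L) {α β : ℕ → ℂ} (hα : Summable α)
    (hβ : Summable β) (hβ0 : ∀ n < L, β n = 0) {G : ℝ → ℂ}
    (hG : ∀ θ, HasSum (fun n => α n * (φ n θ : ℂ) - β n * (φ (aliasIndex L n) θ : ℂ)) (G θ)) :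
    (L : ℝ≥0∞) ^ 2 * ∫⁻ θ in Ioo 0 π, ‖G θ‖ₑ ^ 2 ≤
      2 * (ENNReal.ofReal π * (L ^ 2 * ∑' n, ‖α n‖ₑ ^ 2) +
        ENNReal.ofReal (2 * π) * ∑' n : ℕ, (n : ℝ≥0∞) ^ 2 * ‖β n‖ₑ ^ 2) := by
  have : NeZero L := ⟨by lia⟩
  have hc := hφ.continuous
  have hbound (γ : ℕ → ℂ) (n k : ℕ) (θ : ℝ) : ‖γ n * (φ k θ : ℂ)‖ ≤ ‖γ n‖ := by
    rw [norm_mul, Complex.norm_real]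
    exact mul_le_of_le_one_right (norm_nonneg _) (hφ1 k θ)
  have hsum {γ : ℕ → ℂ} (hγ : Summable γ) (τ : ℕ → ℕ) (θ : ℝ) :
      Summable fun n => γ n * (φ (τ n) θ : ℂ) :=
    hγ.norm.of_norm_bounded fun n => hbound γ n (τ n) θ
  set P : ℝ → ℂ := fun θ => ∑' n, α n * (φ n θ : ℂ)
  set Q : ℝ → ℂ := fun θ => ∑' n, β n * (φ (aliasIndex L n) θ : ℂ)
  have hPc : Continuous P := continuous_tsum (fun n => by fun_prop) hα.norm fun n => hbound α n n
  have hGPQ (θ : ℝ) : G θ = P θ - Q θ :=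
    (hG θ).unique ((hsum hα id θ).hasSum.sub (hsum hβ _ θ).hasSum)
  have hPint := hφ.lintegral_hasSum_sq_le α (G := P) fun θ _ => (hsum hα id θ).hasSum
  have hQint := hφ.lintegral_hasSum_blocks_sq_le aliasIndex_block_injective hβ0 (G := Q)
    fun θ _ => (hsum hβ _ θ).hasSum
  calc (L : ℝ≥0∞) ^ 2 * ∫⁻ θ in Ioo 0 π, ‖G θ‖ₑ ^ 2
      ≤ L ^ 2 * ∫⁻ θ in Ioo 0 π, 2 * (‖P θ‖ₑ ^ 2 + ‖Q θ‖ₑ ^ 2) := by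
        gcongr with θ
        rw [hGPQ]
        exact enorm_sub_sq_le _ _
    _ = 2 * (L ^ 2 * (∫⁻ θ in Ioo 0 π, ‖P θ‖ₑ ^ 2) + L ^ 2 * ∫⁻ θ in Ioo 0 π, ‖Q θ‖ₑ ^ 2) := by
        rw [lintegral_const_mul' _ _ (by simp),
          lintegral_add_left (hPc.measurable.enorm.pow_const 2)]
        ring
    _ ≤ 2 * (L ^ 2 * (ENNReal.ofReal π * ∑' n, ‖α n‖ₑ ^ 2) +
          ENNReal.ofReal (2 * π) * ∑' n : ℕ, (n : ℝ≥0∞) ^ 2 * ‖β n‖ₑ ^ 2) := by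
        gcongr
    _ = _ := by ring

/-- The interpolation error is the case `K = 1`, its derivative the case `K = L`. -/
theorem IsOrthoSystem.lintegral_aliased_tail_sq_le {φ : ℕ → ℝ → ℝ} (hφ : IsOrthoSystem φ)
    (hφ1 : ∀ n θ, |φ n θ| ≤ 1) {L : ℕ} (hL : 1 ≤ L) {a α β : ℕ → ℂ} {K : ℝ≥0∞} (hα : Summable α)
    (hβ : Summable β) (hαa : ∀ n, L * ‖α n‖ₑ ≤ K * (n * ‖tail L a n‖ₑ))
    (hβa : ∀ n, ‖β n‖ₑ ≤ K * ‖tail L a n‖ₑ) {G : ℝ → ℂ}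
    (hG : ∀ θ, HasSum (fun n => α n * (φ n θ : ℂ) - β n * (φ (aliasIndex L n) θ : ℂ)) (G θ)) :
    (L : ℝ≥0∞) ^ 2 * ∫⁻ θ in Ioo 0 π, ‖G θ‖ₑ ^ 2 ≤
      K ^ 2 * (ENNReal.ofReal (6 * π) * ∑' n : ℕ, (n : ℝ≥0∞) ^ 2 * ‖tail L a n‖ₑ ^ 2) := by
  have hβ0 (n : ℕ) (hn : n < L) : β n = 0 := by simpa [tail_of_le a hn.le] using hβa n
  set A := ∑' n : ℕ, (n : ℝ≥0∞) ^ 2 * ‖tail L a n‖ₑ ^ 2 with hA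
  have hαA : (L : ℝ≥0∞) ^ 2 * ∑' n, ‖α n‖ₑ ^ 2 ≤ K ^ 2 * A := by
    simp_rw [hA, ← ENNReal.tsum_mul_left, ← mul_pow]
    exact ENNReal.tsum_le_tsum fun n => pow_le_pow_left' (hαa n) 2
  have hβA : ∑' n : ℕ, (n : ℝ≥0∞) ^ 2 * ‖β n‖ₑ ^ 2 ≤ K ^ 2 * A := by
    simp_rw [hA, ← ENNReal.tsum_mul_left, ← mul_pow, mul_left_comm K]
    gcongr with n
    exact hβa n
  refine (hφ.lintegral_aliased_sq_le hφ1 hL hα hβ hβ0 hG).trans ?_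
  calc 2 * (ENNReal.ofReal π * (L ^ 2 * ∑' n, ‖α n‖ₑ ^ 2) +
        ENNReal.ofReal (2 * π) * ∑' n : ℕ, (n : ℝ≥0∞) ^ 2 * ‖β n‖ₑ ^ 2)
      ≤ 2 * (ENNReal.ofReal π * (K ^ 2 * A) + ENNReal.ofReal (2 * π) * (K ^ 2 * A)) := by
        gcongr
    _ = K ^ 2 * (ENNReal.ofReal (6 * π) * A) := by
        rw [← add_mul, ← ENNReal.ofReal_add pi_pos.le (by positivity), ← mul_assoc,
          ← ENNReal.ofReal_ofNat 2, ← ENNReal.ofReal_mul two_pos.le, mul_left_comm]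
        ring_nf

theorem summable_of_summable_tail {L : ℕ} {a : ℕ → ℂ} (h : Summable (tail L a)) : Summable a := by
  refine (summable_congr_cofinite ?_).1 h
  filter_upwards [(finite_Iic L).compl_mem_cofinite] with n hn
  exact indicator_of_mem (by simpa using hn) a

theorem summable_tail_of_tsum_sq_ne_top {L : ℕ} (hL : 1 ≤ L) {a : ℕ → ℂ}
    (h : ∑' n : ℕ, (n : ℝ≥0∞) ^ 2 * ‖tail L a n‖ₑ ^ 2 ≠ ∞) : Summable (tail L a) := by
  have hCS := mul_tsum_sq_le hL (a := fun n => ‖tail L a n‖ₑ) fun n hn => by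
    rw [tail_of_le a hn.le, enorm_zero]
  refine Summable.of_enorm fun htop => ?_
  rw [htop, ENNReal.top_pow two_ne_zero, ENNReal.mul_top (Nat.cast_ne_zero.2 (by lia)), top_le_iff]
    at hCS
  exact ENNReal.mul_ne_top ENNReal.ofNat_ne_top h hCS

theorem mul_rhoNorm_zero_interpError_sq_le {L : ℕ} (hL : 1 ≤ L) {f : ℝ → ℂ}
    (hf : ContinuousOn f (Icc 0 2)) :
    (L : ℝ≥0∞) ^ 2 * rhoNorm 0 (interpError L f) ^ 2 ≤
      ENNReal.ofReal (6 * π) *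
        ∑' n : ℕ, (n : ℝ≥0∞) ^ 2 * ‖tail L (chebCoeff f) n‖ₑ ^ 2 := by
  by_cases hA : ∑' n : ℕ, (n : ℝ≥0∞) ^ 2 * ‖tail L (chebCoeff f) n‖ₑ ^ 2 = ∞
  · rw [hA, ENNReal.mul_top (by simp [pi_pos])]
    exact le_top
  have hs := summable_tail_of_tsum_sq_ne_top hL hA
  rw [rhoNorm_sq]
  simp only [mul_zero, pow_zero, ENNReal.ofReal_one, mul_one]
  refine (isOrthoSystem_cos.lintegral_aliased_tail_sq_le (fun n θ => abs_cos_le_one _) hL hs hs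
    (K := 1) (fun n => ?_) (fun n => (one_mul _).ge) fun θ => ?_).trans_eq
      (by rw [one_pow, one_mul])
  · rcases le_or_gt n L with h | h
    · simp [tail_of_le _ h]
    · rw [one_mul]
      gcongr
  · simpa only [mul_sub] using
      hasSum_interpError hL (hasSum_chebCoeff hf (summable_of_summable_tail hs)) θ

theorem tendsto_symmQuotient {E : Type*} [NormedAddCommGroup E] [NormedSpace ℝ E] {g : ℝ → E}
    {g' : E} {θ : ℝ} (h : HasDerivAt g g' θ) {u : ℕ → ℝ} (hu : Tendsto u atTop (𝓝[≠] 0)) :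
    Tendsto (fun j => (2 * u j)⁻¹ • (g (θ + u j) - g (θ - u j))) atTop (𝓝 g') := by
  have hslope := hasDerivAt_iff_tendsto_slope_zero.1 h
  have huneg : Tendsto (fun j => -u j) atTop (𝓝[≠] 0) := by
    refine tendsto_nhdsWithin_iff.2 ⟨by simpa using (tendsto_nhds_of_tendsto_nhdsWithin hu).neg, ?_⟩
    filter_upwards [(tendsto_nhdsWithin_iff.1 hu).2] with j hj using neg_ne_zero.2 hj
  have hmean := ((hslope.comp hu).add (hslope.comp huneg)).const_smul (2⁻¹ : ℝ)
  rw [← two_smul ℝ g', inv_smul_smul₀ two_ne_zero] at hmean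
  refine hmean.congr fun j => ?_
  simp only [Function.comp_apply, ← sub_eq_add_neg, inv_neg, mul_inv]
  module

theorem lintegral_enorm_deriv_sq_le {E : Type*} [NormedAddCommGroup E] [NormedSpace ℝ E]
    [MeasurableSpace E] [BorelSpace E] {μ : Measure ℝ} {g : ℝ → E} (hg : Continuous g) {C : ℝ≥0∞}
    (hC : ∀ h > 0, ∫⁻ θ, ‖(2 * h)⁻¹ • (g (θ + h) - g (θ - h))‖ₑ ^ 2 ∂μ ≤ C) :
    ∫⁻ θ, ‖deriv g θ‖ₑ ^ 2 ∂μ ≤ C := by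
  have hu : Tendsto (fun j : ℕ => 1 / ((j : ℝ) + 1)) atTop (𝓝[≠] 0) :=
    tendsto_nhdsWithin_iff.2 ⟨tendsto_one_div_add_atTop_nhds_zero_nat,
      Eventually.of_forall fun j => by simpa using (by positivity : (j : ℝ) + 1 ≠ 0)⟩
  refine lintegral_enorm_sq_le_of_tendsto
    (fun j => (Continuous.measurable (by fun_prop)).aemeasurable)
    (ae_of_all _ fun θ hθ => ?_) fun j : ℕ => hC (1 / (j + 1)) (by positivity)
  exact tendsto_symmQuotient (differentiableAt_of_deriv_ne_zero hθ).hasDerivAt hu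

theorem continuous_interpError_comp_cos (L : ℕ) {f : ℝ → ℂ} (hf : ContinuousOn f (Icc 0 2)) :
    Continuous fun θ => interpError L f (1 + cos θ) :=
  (hf.comp_continuous (by fun_prop) one_add_cos_mem_Icc).sub
    ((Polynomial.continuous _).comp (by fun_prop))

theorem rhoNorm_one_deriv_sq (g : ℝ → ℂ) :
    rhoNorm 1 (deriv g) ^ 2 = ∫⁻ θ in Ioo 0 π, ‖deriv (fun θ => g (1 + cos θ)) θ‖ₑ ^ 2 := by
  rw [rhoNorm_sq]
  refine setLIntegral_congr_fun measurableSet_Ioo fun θ hθ => ?_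
  have hsin := sin_pos_of_mem_Ioo hθ
  rw [deriv_comp_of_hasStrictDerivAt ((hasStrictDerivAt_cos θ).const_add 1)
    (neg_ne_zero.2 hsin.ne'), enorm_smul, mul_pow, mul_comm, enorm_neg,
    Real.enorm_of_nonneg hsin.le, ENNReal.ofReal_pow hsin.le, mul_one]

theorem enorm_sin_mul_div_le (k : ℕ) {h : ℝ} (hh : 0 < h) : ‖sin (k * h) / h‖ₑ ≤ k := by
  rw [← ofReal_norm, ← ENNReal.ofReal_natCast]
  gcongr
  rw [norm_div, Real.norm_of_nonneg hh.le, div_le_iff₀ hh, Real.norm_eq_abs]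
  exact abs_sin_le_abs.trans_eq (abs_of_nonneg (by positivity))

theorem hasSum_symmQuotient {L : ℕ} {a : ℕ → ℂ} {g : ℝ → ℂ}
    (hg : ∀ θ : ℝ, HasSum (fun n : ℕ => a n * ((cos (n * θ) : ℂ) - cos (aliasIndex L n * θ)))
      (g θ)) (h θ : ℝ) :
    HasSum (fun n : ℕ => -(sin (n * h) / h) • a n * (sin (n * θ) : ℂ) -
        -(sin (aliasIndex L n * h) / h) • a n * (sin (aliasIndex L n * θ) : ℂ))
      ((2 * h)⁻¹ • (g (θ + h) - g (θ - h))) := by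
  have hcos (k : ℕ) : (cos (k * (θ + h)) : ℂ) - cos (k * (θ - h)) =
      -2 * sin (k * h) * sin (k * θ) := by
    rw [mul_add, mul_sub, cos_add, cos_sub]
    push_cast
    ring
  refine (congrArg (HasSum · _) (funext fun n => ?_)).mp
    (((hg (θ + h)).sub (hg (θ - h))).const_smul (2 * h)⁻¹)
  have hn := hcos n
  have halias := hcos (aliasIndex L n)
  simp only [Complex.real_smul]
  push_cast at hn halias ⊢
  linear_combination (2 * (h : ℂ))⁻¹ * a n * (hn - halias)

theorem lintegral_enorm_symmQuotient_sq_le {L : ℕ} (hL : 1 ≤ L) {a : ℕ → ℂ}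
    (ha : Summable (tail L a)) {g : ℝ → ℂ} (hg : ∀ θ : ℝ, HasSum
      (fun n : ℕ => tail L a n * ((cos (n * θ) : ℂ) - cos (aliasIndex L n * θ))) (g θ))
    {h : ℝ} (hh : 0 < h) :
    ∫⁻ θ in Ioo 0 π, ‖(2 * h)⁻¹ • (g (θ + h) - g (θ - h))‖ₑ ^ 2 ≤
      ENNReal.ofReal (6 * π) * ∑' n : ℕ, (n : ℝ≥0∞) ^ 2 * ‖tail L a n‖ₑ ^ 2 := by
  have hfactor (k : ℕ) (z : ℂ) : ‖-(sin (k * h) / h) • z‖ₑ ≤ k * ‖z‖ₑ := by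
    rw [enorm_smul, enorm_neg]
    gcongr
    exact enorm_sin_mul_div_le k hh
  have hsummable (τ : ℕ → ℕ) : Summable fun n => -(sin (τ n * h) / h) • tail L a n := by
    refine (ha.norm.mul_left h⁻¹).of_norm_bounded fun n => ?_
    rw [norm_smul, norm_neg, norm_div, Real.norm_of_nonneg hh.le, div_eq_inv_mul]
    gcongr
    exact mul_le_of_le_one_right (by positivity) (abs_sin_le_one _)
  have hL0 : (L : ℝ≥0∞) ^ 2 ≠ 0 := pow_ne_zero 2 (Nat.cast_ne_zero.2 (by lia))
  refine (ENNReal.mul_le_mul_iff_right hL0 (by simp)).1 ?_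
  refine isOrthoSystem_sin.lintegral_aliased_tail_sq_le (fun n θ => abs_sin_le_one _) hL
    (hsummable id) (hsummable (aliasIndex L)) (fun n => ?_) (fun n => ?_)
    (hasSum_symmQuotient hg h)
  · gcongr
    exact hfactor n _
  · refine (hfactor _ _).trans ?_
    gcongr
    exact aliasIndex_le hL n

theorem rhoNorm_one_deriv_interpError_sq_le {L : ℕ} (hL : 1 ≤ L) {f : ℝ → ℂ}
    (hf : ContinuousOn f (Icc 0 2)) :
    rhoNorm 1 (deriv (interpError L f)) ^ 2 ≤
      ENNReal.ofReal (6 * π) *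
        ∑' n : ℕ, (n : ℝ≥0∞) ^ 2 * ‖tail L (chebCoeff f) n‖ₑ ^ 2 := by
  by_cases hA : ∑' n : ℕ, (n : ℝ≥0∞) ^ 2 * ‖tail L (chebCoeff f) n‖ₑ ^ 2 = ∞
  · rw [hA, ENNReal.mul_top (by simp [pi_pos])]
    exact le_top
  have hs := summable_tail_of_tsum_sq_ne_top hL hA
  rw [rhoNorm_one_deriv_sq]
  exact lintegral_enorm_deriv_sq_le (continuous_interpError_comp_cos L hf) fun h hh =>
    lintegral_enorm_symmQuotient_sq_le hL hs
      (hasSum_interpError hL (hasSum_chebCoeff hf (summable_of_summable_tail hs))) hh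

/-! ### Uniform bounds -/

theorem supNorm_le {g : ℝ → ℂ} {C : ℝ≥0∞} (h : ∀ s ∈ Ioo (0 : ℝ) 2, ‖g s‖ₑ ≤ C) :
    supNorm g ≤ C := by
  rw [supNorm, eLpNorm_exponent_top]
  exact eLpNormEssSup_le_of_ae_enorm_bound (ae_restrict_of_forall_mem measurableSet_Ioo h)

theorem abs_chebT_one_le (n : ℕ) {x : ℝ} (hx : |x| ≤ 1) : |chebT n 1 x| ≤ (n : ℝ) ^ 2 :=
  (Polynomial.Chebyshev.abs_iterate_derivative_T_real_le n 1 hx).trans_eq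
    (by simp [Polynomial.Chebyshev.derivative_T_eval_one])

open Polynomial in
theorem abs_sin_mul_eval_derivative_U_le (k : ℕ) (θ : ℝ) :
    |sin θ * (derivative (Chebyshev.U ℝ k)).eval (cos θ)| ≤ k * (k + 1) := by
  induction k using Nat.twoStepInduction with
  | zero => simp
  | one =>
    have hsin := abs_sin_le_one θ
    simp only [Nat.cast_one, Chebyshev.U_one, derivative_mul, derivative_ofNat, zero_mul,
      derivative_X, mul_one, zero_add, eval_ofNat, abs_mul, abs_two]
    linarith
  | more k ih _ =>
    have hrec : sin θ * (derivative (Chebyshev.U ℝ ((k + 2 : ℕ) : ℤ))).eval (cos θ) =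
        2 * (k + 2) * sin ((k + 2) * θ) +
          sin θ * (derivative (Chebyshev.U ℝ k)).eval (cos θ) := by
      have hU := Chebyshev.U_real_cos θ ((k : ℤ) + 1)
      have hT := congrArg (fun p => eval (cos θ) (derivative p))
        (Chebyshev.U_eq_two_mul_T_add_U ℝ k)
      simp only [derivative_add, derivative_mul, derivative_ofNat, zero_mul, zero_add, eval_add,
        eval_mul, eval_ofNat, Chebyshev.T_derivative_eq_U, eval_intCast,
        show (k : ℤ) + 2 - 1 = k + 1 by ring] at hT
      push_cast at hT hU ⊢
      rw [hT, show (k : ℝ) + 2 = k + 1 + 1 by ring, ← hU]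
      ring
    have hsin := abs_sin_le_one ((k + 2) * θ)
    rw [hrec]
    refine (abs_add_le _ _).trans ?_
    rw [abs_mul, abs_of_nonneg (by positivity : (0 : ℝ) ≤ 2 * (k + 2))]
    push_cast
    nlinarith [(k.cast_nonneg : (0 : ℝ) ≤ k)]

theorem abs_sin_mul_chebT_two_le (n : ℕ) (θ : ℝ) :
    |sin θ * chebT n 2 (cos θ)| ≤ (n : ℝ) ^ 3 := by
  rcases n with _ | n
  · simp [chebT]
  have hU : chebT (n + 1) 2 (cos θ) =
      (n + 1) * (Polynomial.derivative (Polynomial.Chebyshev.U ℝ n)).eval (cos θ) := by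
    simp [chebT, Polynomial.Chebyshev.T_derivative_eq_U]
  rw [hU, mul_left_comm, abs_mul, abs_of_nonneg (by positivity)]
  push_cast
  calc ((n : ℝ) + 1) * |sin θ * _| ≤ (n + 1) * (n * (n + 1)) := by
        gcongr
        exact abs_sin_mul_eval_derivative_U_le n θ
    _ ≤ (n + 1) ^ 3 := by nlinarith [sq_nonneg ((n : ℝ) + 1), (n.cast_nonneg : (0 : ℝ) ≤ n)]

theorem rho_one_pos {s : ℝ} (hs : s ∈ Ioo (0 : ℝ) 2) : 0 < rho 1 s :=
  rpow_pos_of_pos (mul_pos hs.1 (sub_pos.2 hs.2)) _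

theorem rho_one_one_add_cos {θ : ℝ} (hθ : θ ∈ Ioo 0 π) : rho 1 (1 + cos θ) = sin θ := by
  refine mul_left_cancel₀ (sin_pos_of_mem_Ioo hθ).ne' ?_
  rw [sin_mul_rho hθ, mul_one, sq]

theorem rho_one_mul_abs_chebT_two_le (n : ℕ) {s : ℝ} (hs : s ∈ Ioo (0 : ℝ) 2) :
    rho 1 s * |chebT n 2 (s - 1)| ≤ (n : ℝ) ^ 3 := by
  rw [← image_one_add_cos] at hs
  obtain ⟨θ, hθ, rfl⟩ := hs
  have h := abs_sin_mul_chebT_two_le n θ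
  simp only [add_sub_cancel_left, rho_one_one_add_cos hθ]
  rwa [abs_mul, abs_of_pos (sin_pos_of_mem_Ioo hθ)] at h

theorem rho_one_le_of_mem_Ioo {δ s : ℝ} (hδ : 0 < δ) (hs : s ∈ Ioo δ (2 - δ)) :
    rho 1 δ ≤ rho 1 s := by
  have hδ2 : δ < 2 - δ := hs.1.trans hs.2
  have hδ0 : 0 ≤ δ * (2 - δ) := by nlinarith
  have hle : δ * (2 - δ) ≤ s * (2 - s) := by nlinarith [hs.1, hs.2]
  unfold rho
  gcongr

/-- The `n`-th term of the Chebyshev series of the `k`-th derivative of the interpolation error: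
the polynomial `T_n` minus its alias, with the `n`-th coefficient. -/
def errTerm (L : ℕ) (a : ℕ → ℂ) (k n : ℕ) (s : ℝ) : ℂ :=
  tail L a n * ((chebT n k (s - 1) - chebT (aliasIndex L n) k (s - 1) : ℝ) : ℂ)

theorem hasDerivAt_errTerm (L : ℕ) (a : ℕ → ℂ) (k n : ℕ) (s : ℝ) :
    HasDerivAt (errTerm L a k n) (errTerm L a (k + 1) n s) s :=
  (((hasDerivAt_chebT n k (s - 1)).sub
    (hasDerivAt_chebT (aliasIndex L n) k (s - 1))).comp_sub_const s 1).ofReal_comp.const_mul _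

section

variable {L : ℕ} (hL : 1 ≤ L) {a : ℕ → ℂ} {k q : ℕ} {s w : ℝ}

include hL

theorem norm_errTerm_le (hw : 0 ≤ w) (h : ∀ n : ℕ, w * |chebT n k (s - 1)| ≤ (n : ℝ) ^ q) (n : ℕ) :
    w * ‖errTerm L a k n s‖ ≤ 2 * ((n : ℝ) ^ q * ‖tail L a n‖) := by
  rcases le_or_gt n L with hn | hn
  · simp [errTerm, tail_of_le a hn]
  have halias : w * |chebT (aliasIndex L n) k (s - 1)| ≤ (n : ℝ) ^ q := (h _).trans (by
    gcongr
    exact (aliasIndex_le hL n).trans hn.le)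
  calc w * ‖errTerm L a k n s‖
      = ‖tail L a n‖ * (w * |chebT n k (s - 1) - chebT (aliasIndex L n) k (s - 1)|) := by
        rw [errTerm, norm_mul, Complex.norm_real, norm_eq_abs]
        ring
    _ ≤ ‖tail L a n‖ * (w * (|chebT n k (s - 1)| + |chebT (aliasIndex L n) k (s - 1)|)) := by
        gcongr
        exact abs_sub _ _
    _ ≤ ‖tail L a n‖ * ((n : ℝ) ^ q + (n : ℝ) ^ q) := by
        rw [mul_add]
        gcongr
        exact h n
    _ = 2 * ((n : ℝ) ^ q * ‖tail L a n‖) := by ring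

theorem enorm_tsum_errTerm_le (hw : 0 ≤ w)
    (h : ∀ n : ℕ, w * |chebT n k (s - 1)| ≤ (n : ℝ) ^ q) :
    ENNReal.ofReal w * ‖∑' n, errTerm L a k n s‖ₑ ≤
      2 * ∑' n : ℕ, (n : ℝ≥0∞) ^ q * ‖tail L a n‖ₑ := by
  rw [← ENNReal.tsum_mul_left]
  calc ENNReal.ofReal w * ‖∑' n, errTerm L a k n s‖ₑ
      ≤ ∑' n, ENNReal.ofReal w * ‖errTerm L a k n s‖ₑ := by
        rw [ENNReal.tsum_mul_left]
        gcongr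
        exact enorm_tsum_le_tsum_enorm
    _ ≤ ∑' n : ℕ, 2 * ((n : ℝ≥0∞) ^ q * ‖tail L a n‖ₑ) := by
        refine ENNReal.tsum_le_tsum fun n => ?_
        have hle := ENNReal.ofReal_le_ofReal (norm_errTerm_le hL (a := a) hw h n)
        rwa [ENNReal.ofReal_mul hw, ENNReal.ofReal_mul two_pos.le,
          ENNReal.ofReal_mul (by positivity), ENNReal.ofReal_pow n.cast_nonneg, ofReal_norm,
          ofReal_norm, ENNReal.ofReal_natCast, ENNReal.ofReal_ofNat] at hle

theorem norm_errTerm_le_inv_mul (hw : 0 < w)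
    (h : ∀ n : ℕ, w * |chebT n k (s - 1)| ≤ (n : ℝ) ^ q) (n : ℕ) :
    ‖errTerm L a k n s‖ ≤ w⁻¹ * (2 * ((n : ℝ) ^ q * ‖tail L a n‖)) := by
  rw [← div_eq_inv_mul, le_div_iff₀' hw]
  exact norm_errTerm_le hL hw.le h n

theorem hasDerivAt_tsum_errTerm {t : Set ℝ} (ht : IsOpen t) (ht' : IsPreconnected t) (hw : 0 < w)
    (h : ∀ y ∈ t, ∀ n : ℕ, w * |chebT n (k + 1) (y - 1)| ≤ (n : ℝ) ^ q)
    (ha : Summable fun n : ℕ => (n : ℝ) ^ q * ‖tail L a n‖) (hs : s ∈ t)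
    (hsum : Summable fun n => errTerm L a k n s) :
    HasDerivAt (fun y => ∑' n, errTerm L a k n y) (∑' n, errTerm L a (k + 1) n s) s :=
  hasDerivAt_tsum_of_isPreconnected ((ha.mul_left 2).mul_left w⁻¹) ht ht'
    (fun n y _ => hasDerivAt_errTerm L a k n y)
    (fun n y hy => norm_errTerm_le_inv_mul hL hw (h y hy) n) hs hsum hs

end

theorem one_mul_abs_chebT_one_le (n : ℕ) {s : ℝ} (hs : s ∈ Ioo (0 : ℝ) 2) :
    1 * |chebT n 1 (s - 1)| ≤ (n : ℝ) ^ 2 := by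
  rw [one_mul]
  exact abs_chebT_one_le n (abs_le.2 ⟨by linarith [hs.1], by linarith [hs.2]⟩)

theorem summable_pow_mul_norm_tail_of_le {L q r : ℕ} {a : ℕ → ℂ} (hqr : q ≤ r)
    (ha : Summable fun n : ℕ => (n : ℝ) ^ r * ‖tail L a n‖) :
    Summable fun n : ℕ => (n : ℝ) ^ q * ‖tail L a n‖ := by
  refine ha.of_nonneg_of_le (fun _ => by positivity) fun n => ?_
  rcases Nat.eq_zero_or_pos n with rfl | hn
  · simp [tail_of_le]
  · have hn1 : (1 : ℝ) ≤ n := mod_cast hn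
    gcongr

theorem summable_pow_mul_norm_tail {L q : ℕ} {a : ℕ → ℂ}
    (ha : ∑' n : ℕ, (n : ℝ≥0∞) ^ q * ‖tail L a n‖ₑ ≠ ∞) :
    Summable fun n : ℕ => (n : ℝ) ^ q * ‖tail L a n‖ := by
  have h := tsum_enorm_ne_top_iff_summable_norm (f := fun n : ℕ => (n : ℝ) ^ q • tail L a n)
  simp only [enorm_smul, enorm_pow, norm_smul, norm_pow, norm_natCast] at h
  refine h.1 ?_
  simpa [Real.enorm_natCast] using ha

section

variable {L : ℕ} (hL : 1 ≤ L) {f : ℝ → ℂ} (hf : ContinuousOn f (Icc 0 2))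

include hL hf

theorem hasSum_errTerm (hcoeff : Summable (chebCoeff f)) {s : ℝ} (hs : s ∈ Ioo (0 : ℝ) 2) :
    HasSum (fun n => errTerm L (chebCoeff f) 0 n s) (interpError L f s) := by
  rw [← image_one_add_cos] at hs
  obtain ⟨θ, -, rfl⟩ := hs
  refine (congrArg (HasSum · _) (funext fun n => ?_)).mp
    (hasSum_interpError hL (hasSum_chebCoeff hf hcoeff) θ)
  simp only [errTerm, add_sub_cancel_left, chebT_zero_cos, Complex.ofReal_sub]

theorem hasDerivAt_interpError
    (ha : Summable fun n : ℕ => (n : ℝ) ^ 2 * ‖tail L (chebCoeff f) n‖) {s : ℝ}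
    (hs : s ∈ Ioo (0 : ℝ) 2) :
    HasDerivAt (interpError L f) (∑' n, errTerm L (chebCoeff f) 1 n s) s := by
  have hcoeff : Summable (chebCoeff f) := by
    have h0 := summable_pow_mul_norm_tail_of_le (Nat.zero_le 2) ha
    simp only [pow_zero, one_mul] at h0
    exact summable_of_summable_tail h0.of_norm
  refine (hasDerivAt_tsum_errTerm hL isOpen_Ioo isPreconnected_Ioo one_pos
    (fun y hy n => one_mul_abs_chebT_one_le n hy) ha hs
    (hasSum_errTerm hL hf hcoeff hs).summable).congr_of_eventuallyEq ?_
  filter_upwards [isOpen_Ioo.mem_nhds hs] with y hy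
  exact (hasSum_errTerm hL hf hcoeff hy).tsum_eq.symm

theorem supNorm_deriv_interpError_le :
    supNorm (deriv (interpError L f)) ≤
      2 * ∑' n : ℕ, (n : ℝ≥0∞) ^ 2 * ‖tail L (chebCoeff f) n‖ₑ := by
  by_cases htop : ∑' n : ℕ, (n : ℝ≥0∞) ^ 2 * ‖tail L (chebCoeff f) n‖ₑ = ∞
  · rw [htop, ENNReal.mul_top two_ne_zero]
    exact le_top
  refine supNorm_le fun s hs => ?_
  rw [(hasDerivAt_interpError hL hf (summable_pow_mul_norm_tail htop) hs).deriv]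
  simpa using enorm_tsum_errTerm_le hL zero_le_one fun n => one_mul_abs_chebT_one_le n hs

theorem iteratedDeriv_two_interpError
    (ha : Summable fun n : ℕ => (n : ℝ) ^ 3 * ‖tail L (chebCoeff f) n‖) {s : ℝ}
    (hs : s ∈ Ioo (0 : ℝ) 2) :
    iteratedDeriv 2 (interpError L f) s = ∑' n, errTerm L (chebCoeff f) 2 n s := by
  have ha2 := summable_pow_mul_norm_tail_of_le (Nat.le_succ 2) ha
  have hsum1 : Summable fun n => errTerm L (chebCoeff f) 1 n s :=
    ((ha2.mul_left 2).mul_left 1⁻¹).of_norm_bounded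
      (norm_errTerm_le_inv_mul hL one_pos fun n => one_mul_abs_chebT_one_le n hs)
  obtain ⟨δ, hδ0, hδ⟩ : ∃ δ > 0, s ∈ Ioo δ (2 - δ) := by
    obtain ⟨δ, hδ0, hδ⟩ := exists_between (lt_min hs.1 (sub_pos.2 hs.2))
    exact ⟨δ, hδ0, hδ.trans_le (min_le_left _ _), by linarith [hδ.trans_le (min_le_right _ _)]⟩
  have hsub : Ioo δ (2 - δ) ⊆ Ioo (0 : ℝ) 2 := Ioo_subset_Ioo hδ0.le (by linarith)
  have hderiv := hasDerivAt_tsum_errTerm hL isOpen_Ioo isPreconnected_Ioo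
    (rho_one_pos ⟨hδ0, hδ.1.trans hs.2⟩) (fun y hy n => le_trans
      (by gcongr; exact rho_one_le_of_mem_Ioo hδ0 hy) (rho_one_mul_abs_chebT_two_le n (hsub hy)))
    ha hδ hsum1
  rw [iteratedDeriv_succ, iteratedDeriv_one, ← hderiv.deriv]
  refine EventuallyEq.deriv_eq ?_
  filter_upwards [isOpen_Ioo.mem_nhds hs] with y hy
  exact (hasDerivAt_interpError hL hf ha2 hy).deriv

theorem supNorm_rho_mul_iteratedDeriv_two_interpError_le :
    supNorm (fun s => (rho 1 s : ℂ) * iteratedDeriv 2 (interpError L f) s) ≤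
      2 * ∑' n : ℕ, (n : ℝ≥0∞) ^ 3 * ‖tail L (chebCoeff f) n‖ₑ := by
  by_cases htop : ∑' n : ℕ, (n : ℝ≥0∞) ^ 3 * ‖tail L (chebCoeff f) n‖ₑ = ∞
  · rw [htop, ENNReal.mul_top two_ne_zero]
    exact le_top
  refine supNorm_le fun s hs => ?_
  have hρ := (rho_one_pos hs).le
  rw [iteratedDeriv_two_interpError hL hf (summable_pow_mul_norm_tail htop) hs, enorm_mul,
    ← ofReal_norm (rho 1 s : ℂ), Complex.norm_of_nonneg hρ]
  exact enorm_tsum_errTerm_le hL hρ fun n => rho_one_mul_abs_chebT_two_le n hs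

end

/-! ### Rates of convergence -/

theorem le_sqrt_mul_rpow_of_pow_mul_sq_le {L k : ℕ} (hL : 1 ≤ L) {c : ℝ≥0} {x y : ℝ≥0∞}
    (h : (L : ℝ≥0∞) ^ k * x ^ 2 ≤ c * y ^ 2) :
    x ≤ NNReal.sqrt c * (L : ℝ≥0∞) ^ (-(k / 2 : ℝ)) * y := by
  have hL0 : (L : ℝ≥0∞) ≠ 0 := Nat.cast_ne_zero.2 (by lia)
  have hroot := ENNReal.rpow_le_rpow h one_half_pos.le
  have hsq : ∀ z : ℝ≥0∞, (z ^ 2) ^ (1 / 2 : ℝ) = z := fun z => by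
    rw [← ENNReal.rpow_natCast_mul]
    norm_num
  rw [ENNReal.mul_rpow_of_nonneg _ _ one_half_pos.le,
    ENNReal.mul_rpow_of_nonneg _ _ one_half_pos.le, hsq, hsq, ← ENNReal.rpow_natCast_mul,
    mul_one_div, ← ENNReal.coe_rpow_of_nonneg _ one_half_pos.le, ← NNReal.sqrt_eq_rpow] at hroot
  calc x = (L : ℝ≥0∞) ^ (-(k / 2 : ℝ)) * ((L : ℝ≥0∞) ^ (k / 2 : ℝ) * x) := by
        rw [← mul_assoc, ← ENNReal.rpow_add _ _ hL0 (ENNReal.natCast_ne_top L), neg_add_cancel,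
          ENNReal.rpow_zero, one_mul]
    _ ≤ (L : ℝ≥0∞) ^ (-(k / 2 : ℝ)) * (NNReal.sqrt c * y) := by gcongr
    _ = NNReal.sqrt c * (L : ℝ≥0∞) ^ (-(k / 2 : ℝ)) * y := by ring

theorem mul_rpow_mul_le_of_exponent_le {L : ℕ} (hL : 1 ≤ L) {p q : ℝ} (hpq : p ≤ q)
    (c : ℝ≥0) (y : ℝ≥0∞) : c * (L : ℝ≥0∞) ^ p * y ≤ c * (L : ℝ≥0∞) ^ q * y := by
  gcongr
  exact Nat.one_le_cast.2 hL

theorem pow_mul_tsum_tail_sq_le (L : ℕ) (a : ℕ → ℂ) {p q : ℕ} :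
    (L : ℝ≥0∞) ^ p * ∑' n : ℕ, (n : ℝ≥0∞) ^ q * ‖tail L a n‖ₑ ^ 2 ≤
      ∑' n : ℕ, (n : ℝ≥0∞) ^ (p + q) * ‖tail L a n‖ₑ ^ 2 := by
  rw [← ENNReal.tsum_mul_left]
  refine ENNReal.tsum_le_tsum fun n => ?_
  rcases le_or_gt n L with h | h
  · simp [tail_of_le a h]
  · rw [pow_add, mul_assoc]
    gcongr

section

variable {m L : ℕ} {f : ℝ → ℂ}

theorem LocSobolev.tsum_pow_mul_enorm_tail_le (hf : LocSobolev m f) {q : ℕ} (hL : 1 ≤ L)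
    (hqm : q + 1 ≤ m) (hmL : m ≤ L + 1) :
    ∑' n : ℕ, (n : ℝ≥0∞) ^ q * ‖tail L (chebCoeff f) n‖ₑ ≤
      NNReal.sqrt (2 * (m : ℝ≥0) ^ m) * (L : ℝ≥0∞) ^ (q + 1 / 2 - m : ℝ) *
        rhoNorm m (iteratedDeriv m f) := by
  obtain ⟨d, rfl⟩ := Nat.exists_eq_add_of_le hqm
  set a : ℕ → ℝ≥0∞ := fun n => (n : ℝ≥0∞) ^ q * ‖tail L (chebCoeff f) n‖ₑ
  have ha : ∀ n < L, a n = 0 := fun n hn => by simp [a, tail_of_le _ hn.le]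
  have hsq : (L : ℝ≥0∞) ^ (2 * d + 1) * (∑' n, a n) ^ 2 ≤
      (2 * ((q + 1 + d : ℕ) : ℝ≥0) ^ (q + 1 + d) : ℝ≥0) *
        rhoNorm (q + 1 + d) (iteratedDeriv (q + 1 + d) f) ^ 2 := by
    calc (L : ℝ≥0∞) ^ (2 * d + 1) * (∑' n, a n) ^ 2
        = (L : ℝ≥0∞) ^ (2 * d) * (L * (∑' n, a n) ^ 2) := by ring
      _ ≤ (L : ℝ≥0∞) ^ (2 * d) * (2 * ∑' n : ℕ, (n : ℝ≥0∞) ^ 2 * a n ^ 2) :=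
        mul_le_mul_right (mul_tsum_sq_le hL ha) _
      _ = 2 * ((L : ℝ≥0∞) ^ (2 * d) *
            ∑' n : ℕ, (n : ℝ≥0∞) ^ (2 * (q + 1)) * ‖tail L (chebCoeff f) n‖ₑ ^ 2) := by
        rw [mul_left_comm]
        congr! 4 with n
        ring
      _ ≤ 2 * ∑' n : ℕ, (n : ℝ≥0∞) ^ (2 * (q + 1 + d)) * ‖tail L (chebCoeff f) n‖ₑ ^ 2 := by
        rw [show 2 * (q + 1 + d) = 2 * d + 2 * (q + 1) by ring]
        gcongr
        exact pow_mul_tsum_tail_sq_le L _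
      _ ≤ 2 * (((q + 1 + d : ℕ) : ℝ≥0∞) ^ (q + 1 + d) *
            rhoNorm (q + 1 + d) (iteratedDeriv (q + 1 + d) f) ^ 2) := by
        exact mul_le_mul_right (hf.tsum_pow_mul_enorm_tail_sq_le (by lia) hmL) _
      _ = _ := by
        push_cast
        ring
  refine (le_sqrt_mul_rpow_of_pow_mul_sq_le hL hsq).trans_eq ?_
  congr 3
  push_cast
  ring

theorem LocSobolev.pow_mul_ofReal_mul_tsum_le (hf : LocSobolev m f) (hm : 1 ≤ m)
    (hmL : m ≤ L + 1) (r : ℝ) :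
    (L : ℝ≥0∞) ^ (2 * (m - 1)) *
        (ENNReal.ofReal r * ∑' n : ℕ, (n : ℝ≥0∞) ^ 2 * ‖tail L (chebCoeff f) n‖ₑ ^ 2) ≤
      (r.toNNReal * (m : ℝ≥0) ^ m : ℝ≥0) * rhoNorm m (iteratedDeriv m f) ^ 2 := by
  rw [mul_left_comm, ENNReal.coe_mul, mul_assoc]
  refine mul_le_mul_right ((pow_mul_tsum_tail_sq_le L _).trans ?_) _
  rw [show 2 * (m - 1) + 2 = 2 * m by lia]
  exact mod_cast hf.tsum_pow_mul_enorm_tail_sq_le hm hmL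

theorem LocSobolev.rhoNorm_zero_interpError_le (hf : LocSobolev m f) (hm : 1 ≤ m) (hL : 1 ≤ L)
    (hmL : m ≤ L + 1) :
    rhoNorm 0 (interpError L f) ≤
      NNReal.sqrt ((6 * π).toNNReal * (m : ℝ≥0) ^ m) * (L : ℝ≥0∞) ^ (-(m : ℝ)) *
        rhoNorm m (iteratedDeriv m f) := by
  have hsq : (L : ℝ≥0∞) ^ (2 * m) * rhoNorm 0 (interpError L f) ^ 2 ≤
      ((6 * π).toNNReal * (m : ℝ≥0) ^ m : ℝ≥0) * rhoNorm m (iteratedDeriv m f) ^ 2 := by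
    rw [show 2 * m = 2 * (m - 1) + 2 by lia, pow_add, mul_assoc]
    exact (mul_le_mul_right (mul_rhoNorm_zero_interpError_sq_le hL hf.continuousOn) _).trans
      (hf.pow_mul_ofReal_mul_tsum_le hm hmL _)
  refine (le_sqrt_mul_rpow_of_pow_mul_sq_le hL hsq).trans_eq ?_
  congr 3
  push_cast
  ring

theorem LocSobolev.rhoNorm_one_deriv_interpError_le (hf : LocSobolev m f) (hm : 1 ≤ m)
    (hL : 1 ≤ L) (hmL : m ≤ L + 1) :
    rhoNorm 1 (deriv (interpError L f)) ≤
      NNReal.sqrt ((6 * π).toNNReal * (m : ℝ≥0) ^ m) * (L : ℝ≥0∞) ^ (1 - m : ℝ) *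
        rhoNorm m (iteratedDeriv m f) := by
  have hsq : (L : ℝ≥0∞) ^ (2 * (m - 1)) * rhoNorm 1 (deriv (interpError L f)) ^ 2 ≤
      ((6 * π).toNNReal * (m : ℝ≥0) ^ m : ℝ≥0) * rhoNorm m (iteratedDeriv m f) ^ 2 :=
    (mul_le_mul_right (rhoNorm_one_deriv_interpError_sq_le hL hf.continuousOn) _).trans
      (hf.pow_mul_ofReal_mul_tsum_le hm hmL _)
  refine (le_sqrt_mul_rpow_of_pow_mul_sq_le hL hsq).trans_eq ?_
  congr 3
  push_cast [Nat.cast_sub hm]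
  ring

theorem LocSobolev.rhoNorm_interpError_add_le (hf : LocSobolev m f) (hm : 1 ≤ m) (hL : 1 ≤ L)
    (hmL : m ≤ L + 1) :
    rhoNorm 0 (interpError L f) + (L : ℝ≥0∞)⁻¹ * rhoNorm 1 (deriv (interpError L f)) ≤
      (2 * NNReal.sqrt ((6 * π).toNNReal * (m : ℝ≥0) ^ m) : ℝ≥0) * (L : ℝ≥0∞) ^ (-(m : ℝ)) *
        rhoNorm m (iteratedDeriv m f) := by
  set c := NNReal.sqrt ((6 * π).toNNReal * (m : ℝ≥0) ^ m)
  have hL0 : (L : ℝ≥0∞) ≠ 0 := Nat.cast_ne_zero.2 (by lia)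
  have hLinv : (L : ℝ≥0∞)⁻¹ * (L : ℝ≥0∞) ^ (1 - m : ℝ) = (L : ℝ≥0∞) ^ (-(m : ℝ)) := by
    rw [← ENNReal.rpow_neg_one, ← ENNReal.rpow_add _ _ hL0 (ENNReal.natCast_ne_top L)]
    congr 1
    ring
  calc rhoNorm 0 (interpError L f) + (L : ℝ≥0∞)⁻¹ * rhoNorm 1 (deriv (interpError L f))
      ≤ c * (L : ℝ≥0∞) ^ (-(m : ℝ)) * rhoNorm m (iteratedDeriv m f) +
        (L : ℝ≥0∞)⁻¹ * (c * (L : ℝ≥0∞) ^ (1 - m : ℝ) * rhoNorm m (iteratedDeriv m f)) := by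
        gcongr
        · exact hf.rhoNorm_zero_interpError_le hm hL hmL
        · exact hf.rhoNorm_one_deriv_interpError_le hm hL hmL
    _ = (2 * c : ℝ≥0) * (L : ℝ≥0∞) ^ (-(m : ℝ)) * rhoNorm m (iteratedDeriv m f) := by
        rw [← hLinv]
        push_cast
        ring

theorem LocSobolev.supNorm_deriv_interpError_le (hf : LocSobolev m f) (hm : 3 ≤ m)
    (hmL : m ≤ L + 1) :
    supNorm (deriv (interpError L f)) ≤
      (2 * NNReal.sqrt (2 * (m : ℝ≥0) ^ m) : ℝ≥0) * (L : ℝ≥0∞) ^ (5 / 2 - m : ℝ) *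
        rhoNorm m (iteratedDeriv m f) := by
  have hL : 1 ≤ L := by lia
  refine (ClenshawCurtis.supNorm_deriv_interpError_le hL hf.continuousOn).trans ?_
  refine (mul_le_mul_right (hf.tsum_pow_mul_enorm_tail_le hL hm hmL) 2).trans_eq ?_
  rw [ENNReal.coe_mul, ENNReal.coe_ofNat, ← mul_assoc, ← mul_assoc,
    show ((2 : ℕ) + 1 / 2 - m : ℝ) = 5 / 2 - m by push_cast; ring]

theorem LocSobolev.supNorm_rho_mul_iteratedDeriv_two_interpError_le (hf : LocSobolev (m + 1) f)
    (hm : 3 ≤ m) (hmL : m ≤ L) :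
    supNorm (fun s => (rho 1 s : ℂ) * iteratedDeriv 2 (interpError L f) s) ≤
      (2 * NNReal.sqrt (2 * ((m + 1 : ℕ) : ℝ≥0) ^ (m + 1)) : ℝ≥0) * (L : ℝ≥0∞) ^ (5 / 2 - m : ℝ) *
        rhoNorm (m + 1) (iteratedDeriv (m + 1) f) := by
  have hL : 1 ≤ L := by lia
  refine (ClenshawCurtis.supNorm_rho_mul_iteratedDeriv_two_interpError_le hL
    hf.continuousOn).trans ?_
  refine (mul_le_mul_right
    (hf.tsum_pow_mul_enorm_tail_le hL (Nat.succ_le_succ hm) (Nat.succ_le_succ hmL)) 2).trans_eq ?_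
  rw [ENNReal.coe_mul, ENNReal.coe_ofNat, ← mul_assoc, ← mul_assoc,
    show ((3 : ℕ) + 1 / 2 - (m + 1 : ℕ) : ℝ) = 5 / 2 - m by push_cast; ring]

end

end ClenshawCurtis

end

open ClenshawCurtis in
theorem proposition3p3_general :
    (∀ m : ℕ, 1 ≤ m → ∃ C : ℝ≥0, 0 < C ∧
      ∀ L : ℕ, 1 ≤ L → m ≤ L + 1 → ∀ f : ℝ → ℂ, LocSobolev m f →
        rhoNorm 0 (interpError L f) + (L : ℝ≥0∞)⁻¹ * rhoNorm 1 (deriv (interpError L f)) ≤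
          C * (L : ℝ≥0∞) ^ (-(m : ℝ)) * rhoNorm m (iteratedDeriv m f)) ∧
    (∀ m : ℕ, 3 ≤ m → ∃ C : ℝ≥0, 0 < C ∧
      (∀ L : ℕ, m ≤ L + 1 → ∀ f : ℝ → ℂ, LocSobolev m f →
        supNorm (deriv (interpError L f)) ≤
          C * (L : ℝ≥0∞) ^ (5 / 2 - m : ℝ) * rhoNorm m (iteratedDeriv m f)) ∧
      (∀ L : ℕ, m ≤ L → ∀ f : ℝ → ℂ, LocSobolev (m + 1) f →
        supNorm (fun s => (rho 1 s : ℂ) * iteratedDeriv 2 (interpError L f) s) ≤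
          C * (L : ℝ≥0∞) ^ (5 / 2 - m : ℝ) *
            rhoNorm (m + 1) (iteratedDeriv (m + 1) f))) := by
  refine ⟨fun m hm => ?_, fun m hm => ?_⟩
  · have hC : 0 < 2 * NNReal.sqrt ((6 * Real.pi).toNNReal * (m : ℝ≥0) ^ m) := by positivity
    exact ⟨_, hC, fun L hL hmL f hf => hf.rhoNorm_interpError_add_le hm hL hmL⟩
  · set C₁ := 2 * NNReal.sqrt (2 * (m : ℝ≥0) ^ m)
    set C₂ := 2 * NNReal.sqrt (2 * ((m + 1 : ℕ) : ℝ≥0) ^ (m + 1))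
    have hC : 0 < max C₁ C₂ := lt_max_of_lt_right (by positivity)
    refine ⟨max C₁ C₂, hC, fun L hmL f hf => ?_, fun L hmL f hf => ?_⟩
    · refine (hf.supNorm_deriv_interpError_le hm hmL).trans ?_
      gcongr
      exact le_max_left C₁ C₂
    · refine (hf.supNorm_rho_mul_iteratedDeriv_two_interpError_le hm hmL).trans ?_
      gcongr
      exact le_max_right C₁ C₂

theorem proposition3p3 :
    (∀ m : ℕ, 1 ≤ m → ∃ C : ℝ≥0, 0 < C ∧
      ∀ L : ℕ, 1 ≤ L → m ≤ L + 1 → ∀ f : ℝ → ℂ, ClenshawCurtis.LocSobolev m f →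
        ClenshawCurtis.rhoNorm 0 (ClenshawCurtis.interpError L f) +
            (L : ℝ≥0∞)⁻¹ * ClenshawCurtis.rhoNorm 1 (deriv (ClenshawCurtis.interpError L f)) ≤
          C * (L : ℝ≥0∞) ^ (-(m : ℝ)) * ClenshawCurtis.rhoNorm m (iteratedDeriv m f)) ∧
    (∀ (m : ℕ) (m₀ : ℝ), 5 / 2 < m₀ → m₀ ≤ m → ∃ C : ℝ≥0, 0 < C ∧
      (∀ L : ℕ, m ≤ L + 1 → ∀ f : ℝ → ℂ, ClenshawCurtis.LocSobolev m f →
        ClenshawCurtis.supNorm (deriv (ClenshawCurtis.interpError L f)) ≤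
          C * (L : ℝ≥0∞) ^ (m₀ - m) * ClenshawCurtis.rhoNorm m (iteratedDeriv m f)) ∧
      (∀ L : ℕ, m ≤ L → ∀ f : ℝ → ℂ, ClenshawCurtis.LocSobolev (m + 1) f →
        ClenshawCurtis.supNorm (fun s => (ClenshawCurtis.rho 1 s : ℂ) *
            iteratedDeriv 2 (ClenshawCurtis.interpError L f) s) ≤
          C * (L : ℝ≥0∞) ^ (m₀ - m) *
            ClenshawCurtis.rhoNorm (m + 1) (iteratedDeriv (m + 1) f))) := by
  refine ⟨proposition3p3_general.1, fun m m₀ hm₀ hm => ?_⟩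
  have hm3 : 3 ≤ m := Nat.succ_le_of_lt (mod_cast (by linarith : (2 : ℝ) < m))
  obtain ⟨C, hC, hderiv, hderiv₂⟩ := proposition3p3_general.2 m hm3
  refine ⟨C, hC, fun L hmL f hf => (hderiv L hmL f hf).trans ?_,
    fun L hmL f hf => (hderiv₂ L hmL f hf).trans ?_⟩ <;>
  exact ClenshawCurtis.mul_rpow_mul_le_of_exponent_le (by lia) (by linarith) C _
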